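/- **Proposition (properties of the Parabolic Mellin Transform).** Powers and logarithms are principal. For $\sigma>0$, $f:\mathbb C\to\mathbb C$ and $z\in\mathbb C$ put $$\mathcal P_\sigma[f](z)=\int_{-\infty}^{\infty}w^{2z}f(w^2)\,dt,\qquad w=\sigma+it,$$ and say that $\mathcal P_\sigma[f](z)$ *converges* if the integral is absolutely convergent. Let $S_\sigma=\{w^2:0\le\operatorname{Re}w\le\sigma\}$ be the closed region inside the parabola $\{(\sigma+it)^2\}$. For real $a,b$ call $f$ *$(\sigma;a,b)$-admissible* if $f$ is holomorphic in a neighbourhood of every point of $S_\sigma\setminus\{0\}$, $f(u)=O(|u|^{-a})$ as $u\to0$, $u\ne 0$, and $f(u)=O(|u|^{-b})$ as $u\to\infty$ in $S_\sigma$; call $h$ *$(\sigma;a,b)$-slit-admissible* if the same holds with $S_\sigma\setminus\{0\}$ and $S_\sigma$ both replaced by $S_\sigma\setminus[0,\infty)$ (also for the limit $u\to 0$). Fix $\sigma>0$. (i) *Linearity.* If $\mathcal P_\sigma[f_1](z)$ and $\mathcal P_\sigma[f_2](z)$ converge, then for $c_1,c_2\in\mathbb C$ so does $\mathcal P_\sigma[c_1f_1+c_2f_2](z)$,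 and it equals $c_1\mathcal P_\sigma[f_1](z)+c_2\mathcal P_\sigma[f_2](z)$. (ii) *Scaling.* Let $\alpha>0$. If $\mathcal P_{\sqrt\alpha\,\sigma}[f](z)$ converges, then $\mathcal P_\sigma[f(\alpha u)](z)$ converges and equals $\alpha^{-(z+1/2)}\mathcal P_{\sqrt\alpha\,\sigma}[f](z)$. If moreover $f$ is holomorphic in a neighbourhood of the closed region between the parabolas of apertures $\sigma$ and $\sqrt\alpha\,\sigma$, with $f(u)=O(|u|^{-b})$ at infinity in it, and $\operatorname{Re}z+\tfrac12<b$, then all these transforms converge and $\mathcal P_\sigma[f(\alpha u)](z)=\alpha^{-(z+1/2)}\mathcal P_\sigma[f](z)$. (iii) *Monomial shift.* For $k\in\mathbb N$ (including $0$), if $\mathcal P_\sigma[f](z+k)$ converges, then $\mathcal P_\sigma[u^kf(u)](z)$ converges and equals $\mathcal P_\sigma[f](z+k)$. (iv) *Differentiation.* If $\mathcal P_\sigma[f](z_0)$ converges and $\operatorname{Re}z<\operatorname{Re}z_0$, then $\mathcal P_\sigma[f(u)\log u](z)$ converges, $\mathcal P_\sigma[f]$ is complex differentiable at $z$, and $\frac{d}{dz}\mathcal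 P_\sigma[f](z)=\mathcal P_\sigma[f(u)\log u](z)$. (v) *Dirichlet composition.* Let $g:\mathbb C\to\mathbb C$ satisfy $g(q)=\sum_{n\ge1}a_nq^n$ for $|q|<1$, and suppose that $u\mapsto g(e^u)$ is holomorphic in a neighbourhood of every point of $S_\sigma\setminus\{0\}$ and meromorphic at $0$. Let $G(z)=\mathcal P_\sigma[e^u](z)$ and $D_g(s)=\sum_{n\ge1}a_nn^{-s}$. Whenever the series $D_g(z+\tfrac12)$ converges (possibly only conditionally), $\mathcal P_\sigma[g(e^u)](z)$ converges and $$\mathcal P_\sigma[g(e^u)](z)=G(z)\,D_g(z+\tfrac12).$$ The same holds for all $z$ with $z+\frac12\in U$ if $U$ is a connected open set and $D_g$ is replaced by a holomorphic function on $U$ to whose values the series converges at all points near some point of $U$. (vi) *Connection to the classical Mellin transform.* Let $f$ be $(\sigma;a,b)$-admissible. If $a<\operatorname{Re}z+\tfrac12<b$, then $\mathcal P_\sigma[f](z)$ and the Mellin transform $\mathcal M[f(-\,\cdot)](s)=\int_0^\infty x^{s-1}f(-x)\,dx$ at $s=z+\tfrac12$ converge absolutely, and $$\mathcal P_\sigma[f](z)=\cos(\pi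 z)\,\mathcal M[f(-\,\cdot)](z+\tfrac12).$$ Moreover, $\mathcal P_\sigma[f]$ is holomorphic on the whole half-plane $\operatorname{Re}z+\tfrac12<b$. (vii) *Parabolic convolution.* Let $(f\star g)(u)=\int_0^\infty f(-y)\,g(u/y)\,\frac{dy}{y}$. Let $f$ be $(\sigma;a_1,b_1)$-admissible and $g$ be $(\sigma;a_2,b_2)$-admissible, and let $h$ (the function $f\star g$, continued from the negative axis) be $(\rho;a_3,b_3)$-slit-admissible for some $\rho>0$, with $h(u)=(f\star g)(u)$ for all $u<0$. If $a_j<\operatorname{Re}z+\tfrac12<b_j$ for $j=1,2,3$, then the integral $(f\star g)(u)$ converges absolutely for all $u<0$, $\mathcal P_{\rho'}[h](z)$ converges for all sufficiently small $\rho'>0$, and, if $\cos(\pi z)\ne0$, $$\lim_{\rho'\downarrow0}\mathcal P_{\rho'}[h](z)=\sec(\pi z)\,\mathcal P_\sigma[f](z)\,\mathcal P_\sigma[g](z).$$ (viii) *Inversion.* Let $0<\theta\le\pi$, let $f$ be $(\sigma;a,b)$-admissible and holomorphic in the sector $\Sigma_\theta=\{u\ne0:|\arg(-u)|<\theta\}$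 (so $\Sigma_\pi=\mathbb C\setminus[0,\infty)$), with $f(u)=O(|u|^{-b})$ at infinity in $\Sigma_\psi$ for every $0<\psi<\theta$. Let $a<\gamma+\tfrac12<b$ and $F=\mathcal P_\sigma[f]$. Then for every $u\in\Sigma_\theta$, with $z=\gamma+i\tau$, $$f(u)=\frac1{2\pi}\int_{-\infty}^{\infty}F(z)\sec(\pi z)\,(-u)^{-(z+1/2)}\,d\tau,$$ the integral being absolutely convergent. -/

import Mathlib

open Filter Topology Asymptotics MeasureTheory

/-- The point `w = σ + i t` of the vertical line of integration. -/
noncomputable def pmtLine (σ t : ℝ) : ℂ := (σ : ℂ) + (t : ℂ) * Complex.I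

/-- The integrand `w ^ (2 z) f (w ^ 2)` with `w = σ + i t` (principal branch). -/
noncomputable def pmtIntegrand (σ : ℝ) (f : ℂ → ℂ) (z : ℂ) (t : ℝ) : ℂ :=
  pmtLine σ t ^ (2 * z) * f (pmtLine σ t ^ 2)

/-- The integral defining the transform with aperture `σ` converges absolutely at `z`. -/
def PMTConvergent (σ : ℝ) (f : ℂ → ℂ) (z : ℂ) : Prop :=
  Integrable (pmtIntegrand σ f z)

/-- The Parabolic Mellin Transform `𝒫[f](z) = ∫ w ^ (2 z) f (w ^ 2) dt`, `w = σ + i t`,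
with aperture `σ`. -/
noncomputable def pmt (σ : ℝ) (f : ℂ → ℂ) (z : ℂ) : ℂ :=
  ∫ t : ℝ, pmtIntegrand σ f z t

/-- The image under `w ↦ w ^ 2` of the closed vertical strip with edges `Re w = σ₁` and
`Re w = σ₂` (in either order): the closed region between the two parabolas. For `σ₁ = 0 < σ₂` it
is the closed region inside the parabola of aperture `σ₂`; it contains `(-∞, 0]` and a
neighbourhood of `0`. -/
def parabolicRegion (σ₁ σ₂ : ℝ) : Set ℂ :=
  (fun w : ℂ => w ^ 2) '' {w : ℂ | w.re ∈ Set.uIcc σ₁ σ₂}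

/-- `f` is holomorphic in a neighbourhood of the closed region inside the parabola of aperture `σ`,
except possibly at `0`, with `f u = O(|u| ^ (-a))` at `0` and `f u = O(|u| ^ (-b))` at infinity
inside that region. -/
structure PMTAdmissible (σ a b : ℝ) (f : ℂ → ℂ) : Prop where
  analytic : AnalyticOnNhd ℂ f (parabolicRegion 0 σ \ {0})
  zero : f =O[𝓝[≠] 0] fun u : ℂ => ‖u‖ ^ (-a)
  infty : f =O[Bornology.cobounded ℂ ⊓ 𝓟 (parabolicRegion 0 σ)] fun u : ℂ => ‖u‖ ^ (-b)

/-- The complement `ℂ \ [0, ∞)` of the closed positive half-line. -/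
def negSlitPlane : Set ℂ := {u : ℂ | ¬ (0 ≤ u.re ∧ u.im = 0)}

/-- The variant of `PMTAdmissible` for functions that live on `ℂ \ [0, ∞)` and may jump across
`[0, ∞)`. -/
structure PMTSlitAdmissible (σ a b : ℝ) (h : ℂ → ℂ) : Prop where
  analytic : AnalyticOnNhd ℂ h (parabolicRegion 0 σ ∩ negSlitPlane)
  zero : h =O[𝓝 0 ⊓ 𝓟 (parabolicRegion 0 σ ∩ negSlitPlane)] fun u : ℂ => ‖u‖ ^ (-a)
  infty : h =O[Bornology.cobounded ℂ ⊓ 𝓟 (parabolicRegion 0 σ ∩ negSlitPlane)]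
    fun u : ℂ => ‖u‖ ^ (-b)

/-- The multiplicative convolution `(f ⋆ g)(u) = ∫₀^∞ f(-y) g(u / y) dy / y`. -/
noncomputable def parabolicConv (f g : ℂ → ℂ) (u : ℂ) : ℂ :=
  ∫ y in Set.Ioi (0 : ℝ), f (-(y : ℂ)) * g (u / (y : ℂ)) / (y : ℂ)

/-- The open sector of half-opening `θ` around the negative real axis. For `θ = π` it is
`ℂ \ [0, ∞)`. -/
def negSector (θ : ℝ) : Set ℂ := {u : ℂ | u ≠ 0 ∧ |(-u).arg| < θ}

/-! Linearity, the monomial shift and scaling between two apertures come from pointwise identities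
of integrands. For differentiation, the integrand at `ζ` is `w ^ (2 * (ζ - z₀))` times an integrable
one, and this multiplier stays bounded on the line even after a factor `log w`, because `|w| ≥ σ`
and `Re ζ < Re z₀`.

The central mechanism is to move the line. Cauchy's theorem (`integral_vertical_eq`) makes the
transform independent of the aperture. As the aperture shrinks to `0` the line becomes the imaginary
axis; there `w = ±it` gives `w ^ 2 = -t ^ 2` with phases `exp (±iπz)`, which add up to `2 cos (πz)`,
and `x = t ^ 2` produces the Mellin transform on the negative axis. The limit (`pmt_tendsto_mellin`)
needs holomorphy only off `[0, ∞)`, so it also covers a convolution that jumps there. The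
convolution formula is then Mellin's (`mellin_convolution`), with one of two cosines divided out.

For inversion, the ray through `u` is rotated to the negative axis, which multiplies the Mellin
transform by an exponential (`mellin_negRay`). The rotated transforms are uniformly bounded, so the
unrotated one decays exponentially on vertical lines, and Mellin inversion applies on the ray.

For the Dirichlet composition, termwise integration proves the formula far to the right. Both
transforms are entire, and summation by parts continues the series holomorphically to the right of a
point of convergence; the identity theorem and Abel's limit theorem (`tendsto_tsum_mul_cpowDiff`)
reach that point itself. -/

@[simp] theorem pmtLine_re (σ t : ℝ) : (pmtLine σ t).re = σ := by simp [pmtLine]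

theorem pmtLine_ne_zero {σ : ℝ} (hσ : 0 < σ) (t : ℝ) : pmtLine σ t ≠ 0 := fun h => by
  have := congrArg Complex.re h
  simp at this
  exact hσ.ne' this

theorem continuous_pmtLine (σ : ℝ) : Continuous (pmtLine σ) := by
  unfold pmtLine; fun_prop

theorem pmtLine_mem_slitPlane {σ : ℝ} (hσ : 0 < σ) (t : ℝ) : pmtLine σ t ∈ Complex.slitPlane :=
  Or.inl (by simpa using hσ)

theorem norm_cpow_le_norm_rpow {w : ℂ} (hw : w ≠ 0) (s : ℂ) :
    ‖w ^ s‖ ≤ Real.exp (Real.pi * |s.im|) * ‖w‖ ^ s.re := by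
  rw [Complex.norm_cpow_of_ne_zero hw, div_eq_mul_inv, ← Real.exp_neg, mul_comm]
  gcongr
  calc -(w.arg * s.im) ≤ |w.arg * s.im| := neg_le_abs _
    _ = |w.arg| * |s.im| := abs_mul _ _
    _ ≤ Real.pi * |s.im| := by gcongr; exact Complex.abs_arg_le_pi w

/-! ### Linearity, monomial shift and scaling -/

theorem pmt_linear {σ : ℝ} {f₁ f₂ : ℂ → ℂ} (c₁ c₂ : ℂ) {z : ℂ} (h₁ : PMTConvergent σ f₁ z)
    (h₂ : PMTConvergent σ f₂ z) :
    PMTConvergent σ (fun u => c₁ * f₁ u + c₂ * f₂ u) z ∧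
      pmt σ (fun u => c₁ * f₁ u + c₂ * f₂ u) z = c₁ * pmt σ f₁ z + c₂ * pmt σ f₂ z := by
  have key : pmtIntegrand σ (fun u => c₁ * f₁ u + c₂ * f₂ u) z =
      fun t => c₁ * pmtIntegrand σ f₁ z t + c₂ * pmtIntegrand σ f₂ z t := by
    funext t; simp only [pmtIntegrand]; ring
  have i₁ := Integrable.const_mul h₁ c₁
  have i₂ := Integrable.const_mul h₂ c₂
  refine ⟨?_, ?_⟩
  · rw [PMTConvergent, key]; exact i₁.add i₂
  · rw [pmt, key, integral_add i₁ i₂, integral_const_mul, integral_const_mul]; rfl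

theorem pmt_monomial {σ : ℝ} (hσ : 0 < σ) {f : ℂ → ℂ} {k : ℕ} {z : ℂ}
    (h : PMTConvergent σ f (z + k)) :
    PMTConvergent σ (fun u => u ^ k * f u) z ∧
      pmt σ (fun u => u ^ k * f u) z = pmt σ f (z + k) := by
  have key : pmtIntegrand σ (fun u => u ^ k * f u) z = pmtIntegrand σ f (z + k) := by
    funext t
    have : (2 * (z + k) : ℂ) = 2 * z + (2 * k : ℕ) := by push_cast; ring
    simp only [pmtIntegrand]
    rw [this, Complex.cpow_add _ _ (pmtLine_ne_zero hσ t), Complex.cpow_natCast, pow_mul]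
    ring
  refine ⟨?_, ?_⟩
  · rw [PMTConvergent, key]; exact h
  · rw [pmt, key]; rfl

theorem pmtLine_mul_sqrt {α : ℝ} (σ t : ℝ) :
    pmtLine (√α * σ) (√α * t) = (√α : ℝ) * pmtLine σ t := by
  simp only [pmtLine]; push_cast; ring

/-- A positive factor leaves the argument unchanged, so no branch correction appears. -/
theorem Complex.ofReal_mul_cpow {r : ℝ} (hr : 0 < r) {w : ℂ} (hw : w ≠ 0) (s : ℂ) :
    ((r : ℂ) * w) ^ s = (r : ℂ) ^ s * w ^ s := by
  have hr' : (r : ℂ) ≠ 0 := by exact_mod_cast hr.ne'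
  rw [Complex.cpow_def_of_ne_zero (mul_ne_zero hr' hw), Complex.cpow_def_of_ne_zero hr',
    Complex.cpow_def_of_ne_zero hw, Complex.log_ofReal_mul hr hw, ← Complex.exp_add,
    Complex.ofReal_log hr.le, add_mul]

theorem pmtIntegrand_comp_mul {α : ℝ} (hα : 0 < α) {σ : ℝ} (hσ : 0 < σ) (f : ℂ → ℂ) (z : ℂ)
    (t : ℝ) :
    pmtIntegrand σ (fun u => f ((α : ℂ) * u)) z t =
      (α : ℂ) ^ (-z) * pmtIntegrand (√α * σ) f z (√α * t) := by
  have hs : 0 < √α := Real.sqrt_pos.2 hα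
  have hα' : (α : ℂ) ≠ 0 := by exact_mod_cast hα.ne'
  have hs' : ((√α : ℝ) : ℂ) ≠ 0 := by exact_mod_cast hs.ne'
  have h2 : ((√α : ℝ) : ℂ) ^ 2 = α := by rw [← Complex.ofReal_pow, Real.sq_sqrt hα.le]
  have h3 : ((√α : ℝ) : ℂ) ^ (2 * z) = (α : ℂ) ^ z := by
    rw [Complex.cpow_def_of_ne_zero hs', Complex.cpow_def_of_ne_zero hα', ← Complex.ofReal_log hs.le,
      ← Complex.ofReal_log hα.le, Real.log_sqrt hα.le]
    congr 1; push_cast; ring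
  have h4 : (α : ℂ) ^ (-z) * (α : ℂ) ^ z = 1 := by
    rw [← Complex.cpow_add _ _ hα', neg_add_cancel, Complex.cpow_zero]
  simp only [pmtIntegrand]
  rw [pmtLine_mul_sqrt, Complex.ofReal_mul_cpow hs (pmtLine_ne_zero hσ t), h3, mul_pow, h2,
    ← mul_assoc, ← mul_assoc, h4, one_mul]

theorem pmt_comp_mul {α : ℝ} (hα : 0 < α) {σ : ℝ} (hσ : 0 < σ) {f : ℂ → ℂ} {z : ℂ}
    (h : PMTConvergent (√α * σ) f z) :
    PMTConvergent σ (fun u => f ((α : ℂ) * u)) z ∧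
      pmt σ (fun u => f ((α : ℂ) * u)) z =
        (α : ℂ) ^ (-(z + 1 / 2)) * pmt (√α * σ) f z := by
  have hs : 0 < √α := Real.sqrt_pos.2 hα
  have key := funext (pmtIntegrand_comp_mul hα hσ f z)
  refine ⟨?_, ?_⟩
  · rw [PMTConvergent, key]
    exact (h.comp_mul_left' hs.ne').const_mul _
  · rw [pmt, key, integral_const_mul, Measure.integral_comp_mul_left (pmtIntegrand (√α * σ) f z),
      abs_of_pos (inv_pos.2 hs), Complex.real_smul, neg_add,
      Complex.cpow_add _ _ (by exact_mod_cast hα.ne'), mul_assoc]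
    congr 2
    rw [show (-(1 / 2) : ℂ) = ((-(1 / 2) : ℝ) : ℂ) by push_cast; ring,
      ← Complex.ofReal_cpow hα.le, Real.rpow_neg hα.le, Real.sqrt_eq_rpow]

/-! ### Differentiation in the parameter -/

theorem exists_norm_cpow_mul_log_le {σ ε : ℝ} (hσ : 0 < σ) (hε : 0 < ε) (Q : ℝ) :
    ∃ K, ∀ w s : ℂ, σ ≤ ‖w‖ → ε ≤ -s.re → -s.re ≤ 3 * ε → |s.im| ≤ Q →
      ‖w ^ s * Complex.log w‖ ≤ K := by
  refine ⟨Real.exp (Real.pi * Q + 4 * ε * |Real.log σ|) * (1 / ε + Real.pi),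
    fun w s hw h1 h2 h3 => ?_⟩
  have hw0 : 0 < ‖w‖ := hσ.trans_le hw
  have hwne : w ≠ 0 := norm_pos_iff.1 hw0
  set L := Real.log ‖w‖ with hL
  have hLσ : Real.log σ ≤ L := Real.log_le_log hσ hw
  -- If `L ≥ 0`, the power itself supplies `exp (-ε L)`. If `L < 0`, then `|L| ≤ |log σ|`: the power
  -- costs at most `3ε |log σ|`, and inserting `exp (-ε |L|)` costs one more `ε |log σ|`.
  have hpow : ‖w ^ s‖ ≤ Real.exp (Real.pi * Q + 4 * ε * |Real.log σ|) * Real.exp (-(ε * |L|)) := by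
    refine (norm_cpow_le_norm_rpow hwne s).trans ?_
    rw [Real.rpow_def_of_pos hw0, ← Real.exp_add, ← Real.exp_add, Real.exp_le_exp]
    have hA : Real.pi * |s.im| ≤ Real.pi * Q := by gcongr
    have hB : L * s.re ≤ 4 * ε * |Real.log σ| - ε * |L| := by
      rcases le_total 0 L with h | h
      · rw [abs_of_nonneg h]
        have : 0 ≤ 4 * ε * |Real.log σ| := by positivity
        nlinarith
      · have : |L| ≤ |Real.log σ| := by
          rw [abs_of_nonpos h, abs_of_nonpos (hLσ.trans h)]; linarith
        rw [abs_of_nonpos h] at this ⊢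
        nlinarith
    linarith
  have hlog : ‖Complex.log w‖ ≤ |L| + Real.pi := by
    refine (Complex.norm_le_abs_re_add_abs_im _).trans ?_
    rw [Complex.log_re, Complex.log_im]
    gcongr
    exact Complex.abs_arg_le_pi w
  have hexp : Real.exp (-(ε * |L|)) * (|L| + Real.pi) ≤ 1 / ε + Real.pi := by
    have h4 : Real.exp (-(ε * |L|)) ≤ 1 := Real.exp_le_one_iff.2 (by simp; positivity)
    have h5 : Real.exp (-(ε * |L|)) * |L| ≤ 1 / ε := by
      rw [Real.exp_neg, inv_mul_le_iff₀ (Real.exp_pos _), mul_one_div, le_div_iff₀ hε]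
      linarith [Real.add_one_le_exp (ε * |L|)]
    nlinarith [Real.pi_pos]
  rw [norm_mul]
  calc ‖w ^ s‖ * ‖Complex.log w‖
      ≤ (Real.exp (Real.pi * Q + 4 * ε * |Real.log σ|) * Real.exp (-(ε * |L|))) *
        (|L| + Real.pi) := by gcongr
    _ ≤ _ := by rw [mul_assoc]; gcongr

/-- The argument lies strictly between `-π/2` and `π/2`, so doubling it stays in the principal
range. -/
theorem Complex.log_sq_of_re_pos {w : ℂ} (hw : 0 < w.re) : Complex.log (w ^ 2) = 2 * Complex.log w := by
  have hw0 : w ≠ 0 := by rintro rfl; simp at hw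
  have h := abs_lt.1 (Complex.abs_arg_lt_pi_div_two_iff.2 (Or.inl hw))
  rw [pow_two, Complex.log_mul hw0 hw0 ⟨by linarith [h.1], by linarith [h.2]⟩]
  ring

theorem pmtIntegrand_eq_cpow_mul {σ : ℝ} (hσ : 0 < σ) (f : ℂ → ℂ) (z z₀ : ℂ) (t : ℝ) :
    pmtIntegrand σ f z t = pmtLine σ t ^ (2 * (z - z₀)) * pmtIntegrand σ f z₀ t := by
  simp only [pmtIntegrand]
  rw [← mul_assoc, ← Complex.cpow_add _ _ (pmtLine_ne_zero hσ t)]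
  congr 2; ring

theorem continuous_pmtLine_cpow {σ : ℝ} (hσ : 0 < σ) (s : ℂ) :
    Continuous fun t => pmtLine σ t ^ s :=
  continuous_iff_continuousAt.2 fun t =>
    (continuousAt_cpow_const (pmtLine_mem_slitPlane hσ t)).comp (f := pmtLine σ)
      (continuous_pmtLine σ).continuousAt

theorem continuous_log_pmtLine {σ : ℝ} (hσ : 0 < σ) :
    Continuous fun t => Complex.log (pmtLine σ t) :=
  (continuous_pmtLine σ).clog (pmtLine_mem_slitPlane hσ)

theorem le_norm_pmtLine {σ : ℝ} (hσ : 0 < σ) (t : ℝ) : σ ≤ ‖pmtLine σ t‖ := by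
  have := Complex.abs_re_le_norm (pmtLine σ t)
  rwa [pmtLine_re, abs_of_pos hσ] at this

theorem PMTConvergent.of_re_le {σ : ℝ} (hσ : 0 < σ) {f : ℂ → ℂ} {z z₀ : ℂ}
    (h : PMTConvergent σ f z₀) (hz : z.re ≤ z₀.re) : PMTConvergent σ f z := by
  rw [PMTConvergent, funext (pmtIntegrand_eq_cpow_mul hσ f z z₀)]
  refine Integrable.bdd_mul h (continuous_pmtLine_cpow hσ _).aestronglyMeasurable
    (c := Real.exp (Real.pi * |(2 * (z - z₀)).im|) * σ ^ (2 * (z - z₀)).re) (ae_of_all _ fun t => ?_)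
  refine (norm_cpow_le_norm_rpow (pmtLine_ne_zero hσ t) _).trans ?_
  refine mul_le_mul_of_nonneg_left ?_ (Real.exp_pos _).le
  refine Real.rpow_le_rpow_of_nonpos hσ (le_norm_pmtLine hσ t) ?_
  simp; linarith

theorem pmt_hasDerivAt {σ : ℝ} (hσ : 0 < σ) {f : ℂ → ℂ} {z z₀ : ℂ}
    (h : PMTConvergent σ f z₀) (hz : z.re < z₀.re) :
    PMTConvergent σ (fun u => f u * Complex.log u) z ∧
      HasDerivAt (pmt σ f) (pmt σ (fun u => f u * Complex.log u) z) z := by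
  -- On the ball of radius `ε` about `z`, the real part of `2 * (ζ - z₀)` stays in `[-6ε, -2ε]`, the
  -- range of the preceding bound with `2 * ε` as its parameter.
  set ε := (z₀.re - z.re) / 2 with hε
  have hε0 : 0 < ε := by rw [hε]; linarith
  obtain ⟨K, hK⟩ := exists_norm_cpow_mul_log_le hσ (ε := 2 * ε) (by linarith)
    (2 * (|(z - z₀).im| + ε))
  have hlog : ∀ t, Complex.log (pmtLine σ t ^ 2) = 2 * Complex.log (pmtLine σ t) := fun t =>
    Complex.log_sq_of_re_pos (by simpa using hσ)
  have hF' : ∀ ζ t, pmtIntegrand σ (fun u => f u * Complex.log u) ζ t =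
      (2 * (pmtLine σ t ^ (2 * (ζ - z₀)) * Complex.log (pmtLine σ t))) *
        pmtIntegrand σ f z₀ t := by
    intro ζ t
    rw [pmtIntegrand_eq_cpow_mul hσ _ ζ z₀]
    simp only [pmtIntegrand, hlog]
    ring
  refine hasDerivAt_integral_of_dominated_loc_of_deriv_le (F := pmtIntegrand σ f)
    (F' := pmtIntegrand σ fun u => f u * Complex.log u) (Metric.ball_mem_nhds z hε0)
    (bound := fun t => 2 * K * ‖pmtIntegrand σ f z₀ t‖) ?_ (h.of_re_le hσ hz.le) ?_ ?_
    (h.norm.const_mul _) ?_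
  · refine Eventually.of_forall fun ζ => ?_
    rw [funext (pmtIntegrand_eq_cpow_mul hσ f ζ z₀)]
    exact (continuous_pmtLine_cpow hσ _).aestronglyMeasurable.mul h.aestronglyMeasurable
  · rw [funext (hF' z)]
    exact ((continuous_const.mul ((continuous_pmtLine_cpow hσ _).mul
      (continuous_log_pmtLine hσ))).aestronglyMeasurable).mul h.aestronglyMeasurable
  · refine ae_of_all _ fun t ζ hζ => ?_
    rw [hF', norm_mul, norm_mul, Complex.norm_two]
    have hd : ‖ζ - z‖ < ε := by simpa [dist_eq_norm] using hζ
    have h1 := abs_le.1 ((Complex.abs_re_le_norm (ζ - z)).trans hd.le)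
    have h2 := (Complex.abs_im_le_norm (ζ - z)).trans hd.le
    gcongr
    refine hK _ _ (le_norm_pmtLine hσ t) ?_ ?_ ?_
    · rw [Complex.sub_re] at h1
      simp; linarith
    · rw [Complex.sub_re] at h1
      simp; linarith
    · have : (2 * (ζ - z₀)).im = 2 * ((z - z₀).im + (ζ - z).im) := by simp
      rw [this, abs_mul, abs_two]
      gcongr
      exact (abs_add_le _ _).trans (by gcongr)
  · refine ae_of_all _ fun t ζ _ => ?_
    have h0 := hlog t
    have hd := (((hasDerivAt_id ζ).const_mul 2).const_cpow (c := pmtLine σ t)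
      (Or.inl (pmtLine_ne_zero hσ t))).mul_const (f (pmtLine σ t ^ 2))
    refine HasDerivAt.congr_deriv (f := fun ζ => pmtIntegrand σ f ζ t) hd ?_
    simp only [pmtIntegrand, h0, id]
    ring

/-! ### Shifting vertical lines of integration -/

theorem integrable_vertical {F : ℂ → ℂ} {S : Set ℝ} {B : ℝ → ℝ}
    (hF : ContinuousOn F {w | w.re ∈ S}) (hBi : Integrable B)
    (hB : ∀ᶠ y : ℝ in cocompact ℝ, ∀ x ∈ S, ‖F (x + y * Complex.I)‖ ≤ B y) {x : ℝ} (hx : x ∈ S) :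
    Integrable fun y : ℝ => F (x + y * Complex.I) := by
  have hc : Continuous fun y : ℝ => F (x + y * Complex.I) := by
    refine hF.comp_continuous (by fun_prop) fun y => ?_
    simpa using hx
  refine hc.locallyIntegrable.integrable_of_isBigO_cocompact ?_
    ((integrable_iff_integrableAtFilter_cocompact.1 hBi).1)
  refine IsBigO.of_bound 1 ?_
  filter_upwards [hB] with y hy
  rw [one_mul]
  exact (hy x hx).trans (Real.le_norm_self _)

/-- Cauchy's theorem on rectangles of height `2T`: the horizontal sides have fixed length and
integrand at most `B (±T)`, so they vanish as `T → ∞`. -/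
theorem integral_vertical_eq {F : ℂ → ℂ} {x₁ x₂ : ℝ} {B : ℝ → ℝ}
    (hF : DifferentiableOn ℂ F {w | w.re ∈ Set.uIcc x₁ x₂})
    (hB0 : Tendsto B (cocompact ℝ) (𝓝 0)) (hBi : Integrable B)
    (hB : ∀ᶠ y : ℝ in cocompact ℝ, ∀ x ∈ Set.uIcc x₁ x₂, ‖F (x + y * Complex.I)‖ ≤ B y) :
    ∫ y : ℝ, F (x₁ + y * Complex.I) = ∫ y : ℝ, F (x₂ + y * Complex.I) := by
  have hi₁ := integrable_vertical hF.continuousOn hBi hB Set.left_mem_uIcc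
  have hi₂ := integrable_vertical hF.continuousOn hBi hB Set.right_mem_uIcc
  have hl₁ := intervalIntegral_tendsto_integral hi₁ tendsto_neg_atTop_atBot tendsto_id
  have hl₂ := intervalIntegral_tendsto_integral hi₂ tendsto_neg_atTop_atBot tendsto_id
  have hor : ∀ c : ℝ → ℝ, Tendsto c atTop (cocompact ℝ) →
      Tendsto (fun T => ∫ x in x₁..x₂, F (x + (c T : ℝ) * Complex.I)) atTop (𝓝 0) := by
    intro c hc
    have hz : Tendsto (fun T => B (c T) * |x₂ - x₁|) atTop (𝓝 0) := by
      simpa using (hB0.comp hc).mul_const |x₂ - x₁|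
    refine squeeze_zero_norm' ?_ hz
    filter_upwards [hc.eventually hB] with T hT
    exact intervalIntegral.norm_integral_le_of_norm_le_const fun x hx =>
      hT x (Set.uIoc_subset_uIcc hx)
  have h₁ := hor (fun T => -T) (tendsto_neg_atTop_atBot.mono_right atBot_le_cocompact)
  have h₂ := hor id (tendsto_id.mono_right atTop_le_cocompact)
  have hlim := (((h₁.sub h₂).add (hl₂.const_smul Complex.I)).sub (hl₁.const_smul Complex.I))
  have hzero : ∀ T : ℝ, (∫ x in x₁..x₂, F (x + (-T : ℝ) * Complex.I)) -
      (∫ x in x₁..x₂, F (x + (id T : ℝ) * Complex.I)) +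
      Complex.I • (∫ y in (-T)..(id T), F (x₂ + y * Complex.I)) -
      Complex.I • (∫ y in (-T)..(id T), F (x₁ + y * Complex.I)) = 0 := by
    intro T
    have := Complex.integral_boundary_rect_eq_zero_of_differentiableOn F ⟨x₁, -T⟩ ⟨x₂, T⟩
      (hF.mono fun w hw => hw.1)
    simpa using this
  have := tendsto_nhds_unique (hlim.congr hzero) tendsto_const_nhds
  rw [sub_zero, zero_add, ← smul_sub, smul_eq_mul, mul_eq_zero] at this
  exact (sub_eq_zero.1 (this.resolve_left Complex.I_ne_zero)).symm

theorem tendsto_one_add_norm_rpow_cocompact {d : ℝ} (hd : 0 < d) (C : ℝ) :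
    Tendsto (fun y : ℝ => C * (1 + ‖y‖) ^ (-d)) (cocompact ℝ) (𝓝 0) := by
  have h := (tendsto_rpow_neg_atTop hd).comp
    (tendsto_atTop_add_const_left _ (1 : ℝ) (tendsto_norm_cocompact_atTop (E := ℝ)))
  simpa using h.const_mul C

/-- The integrand of the transform as a function of `w`. -/
noncomputable def pmtKernel (f : ℂ → ℂ) (z w : ℂ) : ℂ := w ^ (2 * z) * f (w ^ 2)

theorem pmtKernel_isBigO {f : ℂ → ℂ} {S : Set ℝ} {b : ℝ} {z : ℂ}
    (hf : f =O[Bornology.cobounded ℂ ⊓ 𝓟 ((fun w : ℂ => w ^ 2) '' {w : ℂ | w.re ∈ S})]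
      fun u : ℂ => ‖u‖ ^ (-b)) (hz : z.re < b) :
    ∃ C, ∀ᶠ y : ℝ in cocompact ℝ, ∀ x ∈ S, ‖pmtKernel f z (x + y * Complex.I)‖ ≤
      C * (1 + ‖y‖) ^ (-(2 * b - 2 * z.re)) := by
  obtain ⟨c, hc⟩ := hf.bound
  rw [eventually_inf_principal, ← comap_norm_atTop, eventually_comap] at hc
  obtain ⟨R, hR⟩ := eventually_atTop.1 hc
  refine ⟨Real.exp (Real.pi * |(2 * z).im|) * (|c| * 2 ^ (2 * b - 2 * z.re)), ?_⟩
  -- The `1` ensures `‖w‖ ^ 2 ≥ ‖w‖ ≥ R`, and later `‖y‖ ≥ (1 + ‖y‖) / 2`, the source of the power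
  -- of `2` in the constant.
  filter_upwards [tendsto_norm_cocompact_atTop.eventually_ge_atTop (max 1 |R|)] with y hy x hx
  set w : ℂ := x + y * Complex.I with hw
  have him : w.im = y := by simp [hw]
  have hyw : ‖y‖ ≤ ‖w‖ := by rw [← him]; exact Complex.abs_im_le_norm w
  have h1 : 1 ≤ ‖w‖ := (le_max_left _ _).trans (hy.trans hyw)
  have hpos : 0 < ‖w‖ := by linarith
  have hne : w ≠ 0 := norm_pos_iff.1 hpos
  have hfw : ‖f (w ^ 2)‖ ≤ |c| * (‖w‖ ^ 2) ^ (-b) := by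
    have h := hR (‖w ^ 2‖) ?_ (w ^ 2) rfl ⟨w, by simpa [hw] using hx, rfl⟩
    · rw [Real.norm_of_nonneg (by positivity), norm_pow] at h
      exact h.trans (by gcongr; exact le_abs_self c)
    · rw [norm_pow]
      have : R ≤ ‖w‖ := (le_abs_self R).trans ((le_max_right _ _).trans (hy.trans hyw))
      nlinarith
  rw [pmtKernel, norm_mul]
  calc ‖w ^ (2 * z)‖ * ‖f (w ^ 2)‖
      ≤ (Real.exp (Real.pi * |(2 * z).im|) * ‖w‖ ^ (2 * z).re) * (|c| * (‖w‖ ^ 2) ^ (-b)) := by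
        gcongr; exact norm_cpow_le_norm_rpow hne _
    _ = Real.exp (Real.pi * |(2 * z).im|) * (|c| * ‖w‖ ^ (-(2 * b - 2 * z.re))) := by
        have : (‖w‖ ^ 2) ^ (-b) = ‖w‖ ^ (-(2 * b)) := by
          rw [← Real.rpow_natCast, ← Real.rpow_mul hpos.le]; congr 1; push_cast; ring
        have h2 : ‖w‖ ^ (-(2 * b - 2 * z.re)) = ‖w‖ ^ (2 * z).re * ‖w‖ ^ (-(2 * b)) := by
          rw [← Real.rpow_add hpos]; congr 1; simp; ring
        rw [this, h2]; ring
    _ ≤ Real.exp (Real.pi * |(2 * z).im|) *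
          (|c| * (2 ^ (2 * b - 2 * z.re) * (1 + ‖y‖) ^ (-(2 * b - 2 * z.re)))) := by
        gcongr
        have h3 : ‖w‖ ^ (-(2 * b - 2 * z.re)) ≤ ((1 + ‖y‖) / 2) ^ (-(2 * b - 2 * z.re)) :=
          Real.rpow_le_rpow_of_nonpos (by positivity) (by linarith) (by linarith)
        refine h3.trans_eq ?_
        rw [Real.div_rpow (by positivity) (by norm_num), Real.rpow_neg (x := 2) (by norm_num),
          div_inv_eq_mul, mul_comm]
    _ = _ := by ring

theorem pmtKernel_differentiableOn {f : ℂ → ℂ} {S : Set ℝ} (hS : ∀ x ∈ S, 0 < x)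
    (hf : AnalyticOnNhd ℂ f ((fun w : ℂ => w ^ 2) '' {w : ℂ | w.re ∈ S})) (z : ℂ) :
    DifferentiableOn ℂ (pmtKernel f z) {w | w.re ∈ S} := by
  intro w hw
  have h1 : DifferentiableAt ℂ (fun w : ℂ => w ^ (2 * z)) w :=
    differentiableAt_id.cpow_const (Or.inl (hS _ hw))
  have h2 : DifferentiableAt ℂ (fun w : ℂ => f (w ^ 2)) w :=
    (hf _ ⟨w, hw, rfl⟩).differentiableAt.comp (f := fun w : ℂ => w ^ 2) w
      (differentiableAt_id.pow 2)
  exact (h1.mul h2).differentiableWithinAt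

theorem pmtIntegrand_eq_kernel (σ : ℝ) (f : ℂ → ℂ) (z : ℂ) :
    pmtIntegrand σ f z = fun t : ℝ => pmtKernel f z (σ + t * Complex.I) := rfl

theorem pmtConvergent_of_mem {f : ℂ → ℂ} {S : Set ℝ} (hS : ∀ x ∈ S, 0 < x)
    (hf : AnalyticOnNhd ℂ f ((fun w : ℂ => w ^ 2) '' {w : ℂ | w.re ∈ S})) {b : ℝ} {z : ℂ}
    (hi : f =O[Bornology.cobounded ℂ ⊓ 𝓟 ((fun w : ℂ => w ^ 2) '' {w : ℂ | w.re ∈ S})]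
      fun u : ℂ => ‖u‖ ^ (-b)) (hz : z.re + 1 / 2 < b) {σ : ℝ} (hσ : σ ∈ S) :
    PMTConvergent σ f z := by
  obtain ⟨C, hC⟩ := pmtKernel_isBigO hi (z := z) (by linarith)
  rw [PMTConvergent, pmtIntegrand_eq_kernel]
  refine integrable_vertical (pmtKernel_differentiableOn hS hf z).continuousOn ?_ hC hσ
  -- Integrability in one real variable needs `2b - 2 Re z > 1`; this is where the shift by `1/2`
  -- originates.
  exact (integrable_one_add_norm (by simp; linarith)).const_mul C

theorem pmt_eq_of_analyticOnNhd {f : ℂ → ℂ} {σ₁ σ₂ : ℝ} (h₁ : 0 < σ₁) (h₂ : 0 < σ₂)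
    (hf : AnalyticOnNhd ℂ f (parabolicRegion σ₁ σ₂)) {b : ℝ} {z : ℂ}
    (hi : f =O[Bornology.cobounded ℂ ⊓ 𝓟 (parabolicRegion σ₁ σ₂)] fun u : ℂ => ‖u‖ ^ (-b))
    (hz : z.re + 1 / 2 < b) : pmt σ₁ f z = pmt σ₂ f z := by
  obtain ⟨C, hC⟩ := pmtKernel_isBigO hi (z := z) (by linarith)
  have hS : ∀ x ∈ Set.uIcc σ₁ σ₂, 0 < x := fun x hx => (lt_min h₁ h₂).trans_le hx.1
  rw [pmt, pmt, pmtIntegrand_eq_kernel, pmtIntegrand_eq_kernel]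
  exact integral_vertical_eq (pmtKernel_differentiableOn hS hf z)
    (tendsto_one_add_norm_rpow_cocompact (by linarith) C)
    ((integrable_one_add_norm (by simp; linarith)).const_mul C) hC

theorem pmt_comp_mul_same {f : ℂ → ℂ} {σ α b : ℝ} {z : ℂ} (hσ : 0 < σ) (hα : 0 < α)
    (hf : AnalyticOnNhd ℂ f (parabolicRegion σ (√α * σ)))
    (hi : f =O[Bornology.cobounded ℂ ⊓ 𝓟 (parabolicRegion σ (√α * σ))] fun u : ℂ => ‖u‖ ^ (-b))
    (hz : z.re + 1 / 2 < b) :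
    PMTConvergent σ f z ∧ PMTConvergent σ (fun u => f ((α : ℂ) * u)) z ∧
      pmt σ (fun u => f ((α : ℂ) * u)) z = (α : ℂ) ^ (-(z + 1 / 2)) * pmt σ f z := by
  have hσ' : 0 < √α * σ := mul_pos (Real.sqrt_pos.2 hα) hσ
  have hS : ∀ x ∈ Set.uIcc σ (√α * σ), 0 < x := fun x hx => (lt_min hσ hσ').trans_le hx.1
  have h := pmt_comp_mul hα hσ (pmtConvergent_of_mem hS hf hi hz Set.right_mem_uIcc)
  refine ⟨pmtConvergent_of_mem hS hf hi hz Set.left_mem_uIcc, h.1, ?_⟩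
  rw [h.2, pmt_eq_of_analyticOnNhd hσ hσ' hf hi hz]

/-! ### Domination by powers and the limit of vanishing aperture -/

/-- The two-sided comparison function `x ^ (-a)` for `x ≤ 1`, `x ^ (-b)` for `x > 1`. -/
noncomputable def powerBound (a b x : ℝ) : ℝ := if x ≤ 1 then x ^ (-a) else x ^ (-b)

theorem powerBound_nonneg (a b : ℝ) {x : ℝ} (hx : 0 ≤ x) : 0 ≤ powerBound a b x := by
  unfold powerBound; split_ifs <;> positivity

theorem powerBound_mono {a b a' b' x : ℝ} (hx : 0 < x) (ha : a ≤ a') (hb : b' ≤ b) :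
    powerBound a b x ≤ powerBound a' b' x := by
  unfold powerBound
  split_ifs with h
  · exact Real.rpow_le_rpow_of_exponent_ge hx h (by linarith)
  · exact Real.rpow_le_rpow_of_exponent_le (by linarith) (by linarith)

theorem powerBound_anti {a b x y : ℝ} (ha : 0 ≤ a) (hb : 0 ≤ b) (hx : 0 < x) (hxy : x ≤ y) :
    powerBound a b y ≤ powerBound a b x := by
  unfold powerBound
  split_ifs with h1 h2 h2
  · exact Real.rpow_le_rpow_of_nonpos hx hxy (by linarith)
  · linarith
  · exact (Real.rpow_le_one_of_one_le_of_nonpos (by linarith) (by linarith)).trans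
      (Real.one_le_rpow_of_pos_of_le_one_of_nonpos hx h2 (by linarith))
  · exact Real.rpow_le_rpow_of_nonpos hx hxy (by linarith)

theorem rpow_mul_powerBound_sq {a b r x : ℝ} (hx : 0 < x) :
    x ^ (2 * r) * powerBound a b (x ^ 2) = powerBound (2 * a - 2 * r) (2 * b - 2 * r) x := by
  have h : x ^ 2 ≤ 1 ↔ x ≤ 1 := by
    rw [sq_le_one_iff₀ hx.le]
  have e : ∀ c : ℝ, x ^ (2 * r) * (x ^ 2) ^ (-c) = x ^ (-(2 * c - 2 * r)) := by
    intro c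
    rw [← Real.rpow_natCast, ← Real.rpow_mul hx.le, ← Real.rpow_add hx]
    congr 1; push_cast; ring
  simp only [powerBound, h]
  split_ifs <;> exact e _

theorem integrableOn_powerBound {a b : ℝ} (ha : a < 1) (hb : 1 < b) :
    IntegrableOn (powerBound a b) (Set.Ioi 0) := by
  rw [← Set.Ioc_union_Ioi_eq_Ioi zero_le_one]
  refine IntegrableOn.union ?_ ?_
  · have h : IntegrableOn (fun x : ℝ => x ^ (-a)) (Set.Ioc 0 1) :=
      (intervalIntegral.intervalIntegrable_rpow' (a := 0) (b := 1) (by linarith)).1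
    exact h.congr_fun (fun x hx => (if_pos hx.2).symm) measurableSet_Ioc
  · have h := integrableOn_Ioi_rpow_of_lt (a := -b) (by linarith) zero_lt_one
    exact h.congr_fun (fun x hx => (if_neg (not_le.2 hx)).symm) measurableSet_Ioi

theorem integrable_comp_abs_of_integrableOn_Ioi {f : ℝ → ℝ} (hf : IntegrableOn f (Set.Ioi 0)) :
    Integrable fun t => f |t| := by
  have hp : IntegrableOn (fun x => f |x|) (Set.Ioi 0) :=
    hf.congr_fun (fun x hx => by rw [abs_of_pos hx]) measurableSet_Ioi
  have hn : IntegrableOn (fun x => f |x|) (Set.Iic 0) := by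
    rw [← Measure.map_neg_eq_self (volume : Measure ℝ)]
    have m : MeasurableEmbedding fun x : ℝ => -x := (Homeomorph.neg ℝ).measurableEmbedding
    rw [m.integrableOn_map_iff]
    simp_rw [Function.comp_def, abs_neg, Set.neg_preimage, Set.neg_Iic, neg_zero]
    exact Iff.mpr integrableOn_Ici_iff_integrableOn_Ioi hp
  rw [← integrableOn_univ, ← Set.Iic_union_Ioi (a := (0 : ℝ))]
  exact hn.union hp

/-- A square is real only if `Re w * Im w = 0`; with `Im w ≠ 0` this puts `w` on the imaginary axis,
where the square is negative. -/
theorem sq_mem_slitRegion {ρ : ℝ} (hρ : 0 ≤ ρ) {w : ℂ} (h0 : 0 ≤ w.re) (h1 : w.re ≤ ρ)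
    (hi : w.im ≠ 0) : w ^ 2 ∈ parabolicRegion 0 ρ ∩ negSlitPlane := by
  refine ⟨⟨w, by simpa [Set.uIcc_of_le hρ] using ⟨h0, h1⟩, rfl⟩, ?_⟩
  rintro ⟨hre, him⟩
  simp only [pow_two, Complex.mul_re, Complex.mul_im] at hre him
  have : w.re = 0 := by
    have : w.re * w.im = 0 := by linarith
    exact (mul_eq_zero.1 this).resolve_right hi
  rw [this] at hre
  have := mul_self_pos.2 hi
  linarith

/-- The majorant depends only on `Im w`, so it dominates all small apertures at once. Replacing
`‖w‖` by the smaller `|Im w|` requires a decreasing bound, hence the `max` with `0` in the exponent.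
-/
theorem norm_pmtKernel_le {h : ℂ → ℂ} {ρ a b C : ℝ} {z : ℂ} (hρ : 0 ≤ ρ) (hC : 0 ≤ C)
    (hb : ∀ u ∈ parabolicRegion 0 ρ ∩ negSlitPlane, ‖h u‖ ≤ C * powerBound a b ‖u‖)
    (hz : z.re ≤ b) {w : ℂ} (h0 : 0 ≤ w.re) (h1 : w.re ≤ ρ) (hi : w.im ≠ 0) :
    ‖pmtKernel h z w‖ ≤ Real.exp (Real.pi * |(2 * z).im|) * C *
      powerBound (max 0 (2 * a - 2 * z.re)) (2 * b - 2 * z.re) |w.im| := by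
  have hpos : 0 < |w.im| := abs_pos.2 hi
  have hle := Complex.abs_im_le_norm w
  have hw : 0 < ‖w‖ := hpos.trans_le hle
  rw [pmtKernel, norm_mul]
  have hre : (2 * z).re = 2 * z.re := by simp
  calc ‖w ^ (2 * z)‖ * ‖h (w ^ 2)‖
      ≤ (Real.exp (Real.pi * |(2 * z).im|) * ‖w‖ ^ (2 * z.re)) *
        (C * powerBound a b (‖w‖ ^ 2)) := by
        rw [← norm_pow, ← hre]
        gcongr
        · exact norm_cpow_le_norm_rpow (norm_pos_iff.1 hw) _
        · exact hb _ (sq_mem_slitRegion hρ h0 h1 hi)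
    _ = Real.exp (Real.pi * |(2 * z).im|) * C *
          powerBound (2 * a - 2 * z.re) (2 * b - 2 * z.re) ‖w‖ := by
        rw [← rpow_mul_powerBound_sq hw]; ring
    _ ≤ _ := by
        gcongr
        exact (powerBound_mono hw (le_max_right _ _) le_rfl).trans
          (powerBound_anti (le_max_left _ _) (by linarith) hpos hle)

theorem pmtKernel_continuousAt {h : ℂ → ℂ} {ρ : ℝ} (hρ : 0 ≤ ρ) (z : ℂ)
    (hc : ∀ u ∈ parabolicRegion 0 ρ ∩ negSlitPlane, ContinuousAt h u) {w : ℂ} (h0 : 0 ≤ w.re)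
    (h1 : w.re ≤ ρ) (hi : w.im ≠ 0) : ContinuousAt (pmtKernel h z) w := by
  refine ContinuousAt.mul (continuousAt_cpow_const (Or.inr hi)) ?_
  exact (hc _ (sq_mem_slitRegion hρ h0 h1 hi)).comp (f := fun w : ℂ => w ^ 2)
    (continuousAt_id.pow 2)

theorem ae_real_ne_zero : ∀ᵐ t : ℝ, t ≠ 0 := by
  simp [ae_iff]

/-- The cosine arises from the principal values `(±I) ^ (2z) = exp (±iπz)` at the two preimages of
`-t ^ 2`. -/
theorem pmtKernel_imaginary_axis {h : ℂ → ℂ} {z : ℂ} {t : ℝ} (ht : 0 < t) :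
    pmtKernel h z (t * Complex.I) + pmtKernel h z ((-t : ℝ) * Complex.I) =
      2 * Complex.cos (Real.pi * z) * ((t : ℂ) ^ (2 * z) * h (-((t ^ (2 : ℝ) : ℝ) : ℂ))) := by
  have hI2 : ∀ t : ℂ, (t * Complex.I) ^ 2 = -(t ^ 2) := fun t => by
    rw [mul_pow, Complex.I_sq]; ring
  have e1 : (Complex.I : ℂ) ^ (2 * z) = Complex.exp (Real.pi * z * Complex.I) := by
    rw [Complex.cpow_def_of_ne_zero Complex.I_ne_zero, Complex.log_I]; congr 1; ring
  have e2 : (-Complex.I : ℂ) ^ (2 * z) = Complex.exp (-(Real.pi * z) * Complex.I) := by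
    rw [Complex.cpow_def_of_ne_zero (neg_ne_zero.2 Complex.I_ne_zero), Complex.log_neg_I]
    congr 1; ring
  have e3 : (((-t : ℝ) : ℂ) * Complex.I) = t * (-Complex.I) := by push_cast; ring
  have e4 : ((t ^ (2 : ℝ) : ℝ) : ℂ) = (t : ℂ) ^ 2 := by
    rw [← Complex.ofReal_pow]; norm_cast
  simp only [pmtKernel, hI2]
  rw [e3, Complex.ofReal_mul_cpow ht Complex.I_ne_zero,
    Complex.ofReal_mul_cpow ht (neg_ne_zero.2 Complex.I_ne_zero), e1, e2, e4, Complex.cos]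
  push_cast
  rw [neg_sq]
  ring

theorem integral_imaginary_axis {h : ℂ → ℂ} {z : ℂ}
    (hi : Integrable fun t : ℝ => pmtKernel h z (t * Complex.I)) :
    ∫ t : ℝ, pmtKernel h z (t * Complex.I) =
      Complex.cos (Real.pi * z) * mellin (fun x : ℝ => h (-(x : ℂ))) (z + 1 / 2) := by
  have hneg : Integrable fun t : ℝ => pmtKernel h z ((-t : ℝ) * Complex.I) := hi.comp_neg
  have h1 : ∫ t in Set.Iic (0 : ℝ), pmtKernel h z (t * Complex.I) =
      ∫ t in Set.Ioi (0 : ℝ), pmtKernel h z ((-t : ℝ) * Complex.I) := by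
    rw [integral_comp_neg_Ioi (0 : ℝ) fun t : ℝ => pmtKernel h z (t * Complex.I), neg_zero]
  rw [← intervalIntegral.integral_Iic_add_Ioi (b := (0 : ℝ)) hi.integrableOn hi.integrableOn, h1,
    add_comm, ← integral_add hi.integrableOn hneg.integrableOn,
    setIntegral_congr_fun measurableSet_Ioi fun t ht => pmtKernel_imaginary_axis (z := z) ht,
    integral_const_mul]
  -- The weight `t ^ (2z)` is `t ^ (s - 1)` with `s = 2z + 1`; substituting `x = t ^ 2` halves `s`,
  -- and its factor `1/2` cancels the `2` before the cosine.
  have h2 := mellin_comp_rpow (fun x : ℝ => h (-(x : ℂ))) (2 * z + 1) 2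
  have h3 : (2 * z + 1) / ((2 : ℝ) : ℂ) = z + 1 / 2 := by push_cast; ring
  rw [h3, mellin] at h2
  simp only [add_sub_cancel_right, smul_eq_mul] at h2
  rw [h2, abs_two, Complex.real_smul]
  push_cast
  ring

theorem pmtKernel_line_aestronglyMeasurable {h : ℂ → ℂ} {ρ : ℝ} (hρ : 0 ≤ ρ) (z : ℂ)
    (hc : ∀ u ∈ parabolicRegion 0 ρ ∩ negSlitPlane, ContinuousAt h u) {x : ℝ} (h0 : 0 ≤ x)
    (h1 : x ≤ ρ) : AEStronglyMeasurable fun t : ℝ => pmtKernel h z (x + t * Complex.I) := by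
  have hcont : ContinuousOn (fun t : ℝ => pmtKernel h z (x + t * Complex.I)) {0}ᶜ := by
    intro t ht
    refine ContinuousAt.continuousWithinAt ?_
    refine ContinuousAt.comp (f := fun t : ℝ => (x : ℂ) + t * Complex.I) (g := pmtKernel h z) ?_ (by fun_prop)
    exact pmtKernel_continuousAt hρ z hc (by simpa using h0) (by simpa using h1)
      (by simpa using ht)
  have := hcont.aestronglyMeasurable (μ := volume) (measurableSet_singleton (0 : ℝ)).compl
  rwa [Measure.restrict_eq_self_of_ae_mem] at this
  exact ae_real_ne_zero

/-- Dominated convergence onto the imaginary axis. The majorant is integrable at `0` because `2a - 2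
Re z < 1` and at infinity because `2b - 2 Re z > 1`. -/
theorem pmt_tendsto_mellin {h : ℂ → ℂ} {ρ a b C : ℝ} {z : ℂ} (hρ : 0 < ρ) (hC : 0 ≤ C)
    (hc : ∀ u ∈ parabolicRegion 0 ρ ∩ negSlitPlane, ContinuousAt h u)
    (hb : ∀ u ∈ parabolicRegion 0 ρ ∩ negSlitPlane, ‖h u‖ ≤ C * powerBound a b ‖u‖)
    (ha : a < z.re + 1 / 2) (hzb : z.re + 1 / 2 < b) :
    (∀ x ∈ Set.Ioc 0 ρ, PMTConvergent x h z) ∧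
      Tendsto (fun x => pmt x h z) (𝓝[>] 0)
        (𝓝 (Complex.cos (Real.pi * z) * mellin (fun x : ℝ => h (-(x : ℂ))) (z + 1 / 2))) := by
  set K := Real.exp (Real.pi * |(2 * z).im|) * C
  set B : ℝ → ℝ := fun t => K * powerBound (max 0 (2 * a - 2 * z.re)) (2 * b - 2 * z.re) |t|
  have hB : Integrable B := (integrable_comp_abs_of_integrableOn_Ioi (integrableOn_powerBound
    (max_lt zero_lt_one (by linarith)) (by linarith))).const_mul K
  have hle : ∀ x : ℝ, 0 ≤ x → x ≤ ρ → ∀ᵐ t : ℝ, ‖pmtKernel h z (x + t * Complex.I)‖ ≤ B t := by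
    intro x h0 h1
    filter_upwards [ae_real_ne_zero] with t ht
    have := norm_pmtKernel_le (z := z) (w := x + t * Complex.I) hρ.le hC hb (by linarith)
      (by simpa using h0) (by simpa using h1) (by simpa using ht)
    rwa [show ((x : ℂ) + t * Complex.I).im = t by simp] at this
  have hint : ∀ x : ℝ, 0 ≤ x → x ≤ ρ →
      Integrable fun t : ℝ => pmtKernel h z (x + t * Complex.I) := fun x h0 h1 =>
    hB.mono' (pmtKernel_line_aestronglyMeasurable hρ.le z hc h0 h1) (hle x h0 h1)
  refine ⟨fun x hx => hint x hx.1.le hx.2, ?_⟩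
  rw [← integral_imaginary_axis (by simpa using hint 0 le_rfl hρ.le)]
  have hev : ∀ᶠ x : ℝ in 𝓝[>] 0, x ∈ Set.Ioc 0 ρ := Ioc_mem_nhdsGT hρ
  refine tendsto_integral_filter_of_dominated_convergence B ?_ ?_ hB ?_
  · filter_upwards [hev] with x hx
    exact pmtKernel_line_aestronglyMeasurable hρ.le z hc hx.1.le hx.2
  · filter_upwards [hev] with x hx using hle x hx.1.le hx.2
  · filter_upwards [ae_real_ne_zero] with t ht
    have hcont : ContinuousAt (fun x : ℝ => pmtKernel h z (x + t * Complex.I)) 0 := by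
      refine ContinuousAt.comp (f := fun x : ℝ => (x : ℂ) + t * Complex.I)
        (g := pmtKernel h z) ?_ (by fun_prop)
      exact pmtKernel_continuousAt hρ.le z hc (by simp) (by simpa using hρ.le) (by simpa using ht)
    have := hcont.tendsto
    simp only [Complex.ofReal_zero, zero_add] at this
    exact this.mono_left nhdsWithin_le_nhds

/-! ### Global power bounds from asymptotic ones -/

theorem one_le_mul_powerBound {a b x : ℝ} (hx : 0 < x) : 1 ≤ (x ^ a + x ^ b) * powerBound a b x := by
  have h : ∀ c : ℝ, x ^ c * x ^ (-c) = 1 := fun c => by rw [← Real.rpow_add hx]; simp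
  unfold powerBound
  split_ifs
  · rw [add_mul, h]
    have : 0 ≤ x ^ b * x ^ (-a) := by positivity
    linarith
  · rw [add_mul, h]
    have : 0 ≤ x ^ a * x ^ (-b) := by positivity
    linarith

/-- The asymptotics settle small and large `‖u‖`. Between them `h` is bounded and the comparison
function is bounded below by a positive constant. The requirement `r ≤ 1` keeps the inner range on
the `-a` branch. -/
theorem exists_powerBound {T : Set ℂ} {h : ℂ → ℂ} {a b r C₀ : ℝ} (hr : 0 < r) (hr1 : r ≤ 1)
    (hT : (0 : ℂ) ∉ T) (h0 : ∀ u ∈ T, ‖u‖ < r → ‖h u‖ ≤ C₀ * ‖u‖ ^ (-a))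
    (hi : h =O[Bornology.cobounded ℂ ⊓ 𝓟 T] fun u : ℂ => ‖u‖ ^ (-b))
    (hmid : ∀ R, ∃ M, ∀ u ∈ T, r ≤ ‖u‖ → ‖u‖ ≤ R → ‖h u‖ ≤ M) :
    ∃ C, 0 ≤ C ∧ ∀ u ∈ T, ‖h u‖ ≤ C * powerBound a b ‖u‖ := by
  obtain ⟨c, hc⟩ := hi.bound
  rw [eventually_inf_principal, ← comap_norm_atTop, eventually_comap] at hc
  obtain ⟨R, hR⟩ := eventually_atTop.1 hc
  obtain ⟨M, hM⟩ := hmid (max R 1)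
  have hcpt : ContinuousOn (fun x : ℝ => x ^ a + x ^ b) (Set.Icc r (max R 1)) := by
    intro x hx
    have : x ≠ 0 := (hr.trans_le hx.1).ne'
    exact ((Real.continuousAt_rpow_const _ _ (Or.inl this)).add
      (Real.continuousAt_rpow_const _ _ (Or.inl this))).continuousWithinAt
  obtain ⟨K, hK⟩ := isCompact_Icc.exists_bound_of_continuousOn hcpt
  refine ⟨|C₀| + |c| + |M| * |K|, by positivity, fun u hu => ?_⟩
  have hpos : 0 < ‖u‖ := norm_pos_iff.2 fun h => hT (h ▸ hu)
  have hpb := powerBound_nonneg a b hpos.le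
  rcases lt_or_ge ‖u‖ r with h1 | h1
  · calc ‖h u‖ ≤ C₀ * ‖u‖ ^ (-a) := h0 u hu h1
      _ ≤ |C₀| * powerBound a b ‖u‖ := by
        rw [powerBound, if_pos (h1.le.trans hr1)]; gcongr; exact le_abs_self _
      _ ≤ _ := by gcongr; linarith [abs_nonneg c, mul_nonneg (abs_nonneg M) (abs_nonneg K)]
  rcases le_or_gt ‖u‖ (max R 1) with h2 | h2
  · have hK' : 1 ≤ |K| * powerBound a b ‖u‖ :=
      (one_le_mul_powerBound hpos).trans (by
        gcongr
        exact (le_abs_self _).trans ((hK _ ⟨h1, h2⟩).trans (le_abs_self K)))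
    calc ‖h u‖ ≤ |M| * 1 := by rw [mul_one]; exact (hM u hu h1 h2).trans (le_abs_self _)
      _ ≤ |M| * (|K| * powerBound a b ‖u‖) := by gcongr
      _ ≤ _ := by
        rw [← mul_assoc]; gcongr; linarith [abs_nonneg c, abs_nonneg C₀]
  · have h3 := hR ‖u‖ ((le_max_left _ _).trans h2.le) u rfl hu
    rw [Real.norm_of_nonneg (by positivity)] at h3
    calc ‖h u‖ ≤ c * ‖u‖ ^ (-b) := h3
      _ ≤ |c| * powerBound a b ‖u‖ := by
        rw [powerBound, if_neg (not_le.2 ((le_max_right _ _).trans_lt h2))]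
        gcongr; exact le_abs_self _
      _ ≤ _ := by gcongr; linarith [abs_nonneg C₀, mul_nonneg (abs_nonneg M) (abs_nonneg K)]

theorem exists_bound_near_zero {T : Set ℂ} {h : ℂ → ℂ} {a : ℝ}
    (h0 : h =O[𝓝 0 ⊓ 𝓟 T] fun u : ℂ => ‖u‖ ^ (-a)) :
    ∃ C r, 0 < r ∧ r ≤ 1 ∧ ∀ u ∈ T, ‖u‖ < r → ‖h u‖ ≤ C * ‖u‖ ^ (-a) := by
  obtain ⟨c, hc⟩ := h0.bound
  rw [eventually_inf_principal] at hc
  obtain ⟨r, hr, hb⟩ := Metric.eventually_nhds_iff.1 hc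
  refine ⟨c, min r 1, lt_min hr one_pos, min_le_right _ _, fun u hu hur => ?_⟩
  have := hb (y := u) (by simpa using hur.trans_le (min_le_left _ _)) hu
  rwa [Real.norm_of_nonneg (by positivity)] at this

theorem parabolicRegion_mono {ρ' ρ : ℝ} (h0 : 0 ≤ ρ') (h : ρ' ≤ ρ) :
    parabolicRegion 0 ρ' ⊆ parabolicRegion 0 ρ := by
  refine Set.image_mono fun w hw => ?_
  simp only [Set.mem_ofPred_eq, Set.uIcc_of_le h0, Set.uIcc_of_le (h0.trans h)] at hw ⊢
  exact ⟨hw.1, hw.2.trans h⟩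

theorem zero_notMem_negSlitPlane : (0 : ℂ) ∉ negSlitPlane := by simp [negSlitPlane]

/-- Nothing controls `h` near the slit away from `0`, so the aperture is shrunk until the part of
the slit inside the region lies in the disc where the bound at `0` holds. -/
theorem PMTSlitAdmissible.exists_bound {ρ a b : ℝ} {h : ℂ → ℂ} (hh : PMTSlitAdmissible ρ a b h)
    (hρ : 0 < ρ) : ∃ ρ' ∈ Set.Ioc 0 ρ, ∃ C, 0 ≤ C ∧
      ∀ u ∈ parabolicRegion 0 ρ' ∩ negSlitPlane, ‖h u‖ ≤ C * powerBound a b ‖u‖ := by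
  obtain ⟨C₀, r, hr, hr1, hC₀⟩ := exists_bound_near_zero hh.zero
  set ρ' := min ρ (r / 2)
  have hρ' : 0 < ρ' := lt_min hρ (by linarith)
  have hsub : parabolicRegion 0 ρ' ∩ negSlitPlane ⊆ parabolicRegion 0 ρ ∩ negSlitPlane :=
    Set.inter_subset_inter_left _ (parabolicRegion_mono hρ'.le (min_le_left _ _))
  refine ⟨ρ', ⟨hρ', min_le_left _ _⟩, exists_powerBound hr hr1
    (fun h => zero_notMem_negSlitPlane h.2) (fun u hu => hC₀ u (hsub hu))
    (hh.infty.mono (inf_le_inf_left _ (principal_mono.2 hsub))) fun R => ?_⟩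
  -- Compactness is used in the `w`-plane. A real `w` in `K` would satisfy `r ≤ w ^ 2 ≤ (r / 2) ^
  -- 2`, impossible for `0 < r ≤ 1`; thus `w ^ 2` avoids the slit on `K`.
  set K : Set ℂ := {w : ℂ | w.re ∈ Set.Icc 0 ρ'} ∩ ({w : ℂ | r ≤ ‖w ^ 2‖} ∩ {w : ℂ | ‖w ^ 2‖ ≤ R})
  have hKclosed : IsClosed K :=
    (isClosed_Icc.preimage Complex.continuous_re).inter
      ((isClosed_le continuous_const (by fun_prop)).inter
        (isClosed_le (by fun_prop) continuous_const))
  have hK : IsCompact K := by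
    refine Metric.isCompact_of_isClosed_isBounded hKclosed
      (isBounded_iff_forall_norm_le.2 ⟨|R| + 1, fun w hw => ?_⟩)
    have h1 : ‖w‖ ^ 2 ≤ R := by rw [← norm_pow]; exact hw.2.2
    nlinarith [norm_nonneg w, le_abs_self R, abs_nonneg R]
  have hcont : ContinuousOn (fun w => h (w ^ 2)) K := by
    intro w hw
    have hmem : w ^ 2 ∈ parabolicRegion 0 ρ ∩ negSlitPlane := by
      refine sq_mem_slitRegion hρ.le hw.1.1 (hw.1.2.trans (min_le_left _ _)) fun him => ?_
      have h2 : ‖w‖ = w.re := by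
        rw [← Complex.re_add_im w, him]
        simp [abs_of_nonneg hw.1.1]
      have h3 : r ≤ w.re ^ 2 := by rw [← h2, ← norm_pow]; exact hw.2.1
      have h4 : w.re ≤ r / 2 := hw.1.2.trans (min_le_right _ _)
      nlinarith [hw.1.1]
    exact ((hh.analytic _ hmem).continuousAt.comp (f := fun w : ℂ => w ^ 2)
      (continuousAt_id.pow 2)).continuousWithinAt
  obtain ⟨M, hM⟩ := hK.exists_bound_of_continuousOn hcont
  refine ⟨M, ?_⟩
  rintro _ ⟨⟨w, hw, rfl⟩, _⟩ h1 h2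
  refine hM w ⟨?_, h1, h2⟩
  simpa [Set.uIcc_of_le hρ'.le] using hw

/-! ### Connection to the classical Mellin transform -/

theorem PMTAdmissible.slitAdmissible {σ a b : ℝ} {f : ℂ → ℂ} (hf : PMTAdmissible σ a b f) :
    PMTSlitAdmissible σ a b f where
  analytic := hf.analytic.mono fun u hu => ⟨hu.1, fun h => zero_notMem_negSlitPlane (h ▸ hu.2)⟩
  zero := hf.zero.mono (by
    refine inf_le_inf_left _ (principal_mono.2 fun u hu h => ?_)
    exact zero_notMem_negSlitPlane (h ▸ hu.2))
  infty := hf.infty.mono (inf_le_inf_left _ (principal_mono.2 Set.inter_subset_left))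

theorem PMTSlitAdmissible.tendsto {ρ a b : ℝ} {h : ℂ → ℂ} (hh : PMTSlitAdmissible ρ a b h)
    (hρ : 0 < ρ) {z : ℂ} (ha : a < z.re + 1 / 2) (hb : z.re + 1 / 2 < b) :
    (∀ᶠ x : ℝ in 𝓝[>] 0, PMTConvergent x h z) ∧
      Tendsto (fun x => pmt x h z) (𝓝[>] 0)
        (𝓝 (Complex.cos (Real.pi * z) * mellin (fun x : ℝ => h (-(x : ℂ))) (z + 1 / 2))) := by
  obtain ⟨ρ', hρ', C, hC, hbd⟩ := hh.exists_bound hρ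
  have hsub : parabolicRegion 0 ρ' ∩ negSlitPlane ⊆ parabolicRegion 0 ρ ∩ negSlitPlane :=
    Set.inter_subset_inter_left _ (parabolicRegion_mono hρ'.1.le hρ'.2)
  obtain ⟨h1, h2⟩ := pmt_tendsto_mellin hρ'.1 hC
    (fun u hu => (hh.analytic u (hsub hu)).continuousAt) hbd ha hb
  exact ⟨by filter_upwards [Ioc_mem_nhdsGT hρ'.1] with x hx using h1 x hx, h2⟩

theorem neg_mem_slitRegion {ρ x : ℝ} (hρ : 0 ≤ ρ) (hx : 0 < x) :
    -(x : ℂ) ∈ parabolicRegion 0 ρ ∩ negSlitPlane := by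
  have h := sq_mem_slitRegion (w := (√x : ℝ) * Complex.I) hρ (by simp) (by simpa using hρ)
    (by simpa using (Real.sqrt_pos.2 hx).ne')
  rwa [mul_pow, Complex.I_sq, ← Complex.ofReal_pow, Real.sq_sqrt hx.le, mul_neg_one] at h

theorem PMTSlitAdmissible.continuousOn_neg {ρ a b : ℝ} {h : ℂ → ℂ}
    (hh : PMTSlitAdmissible ρ a b h) (hρ : 0 ≤ ρ) :
    ContinuousOn (fun x : ℝ => h (-(x : ℂ))) (Set.Ioi 0) := fun x hx =>
  ((hh.analytic _ (neg_mem_slitRegion hρ hx)).continuousAt.comp (f := fun x : ℝ => -(x : ℂ))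
    (by fun_prop)).continuousWithinAt

theorem PMTSlitAdmissible.isBigO_neg_zero {ρ a b : ℝ} {h : ℂ → ℂ}
    (hh : PMTSlitAdmissible ρ a b h) (hρ : 0 ≤ ρ) :
    (fun x : ℝ => h (-(x : ℂ))) =O[𝓝[>] 0] fun x : ℝ => x ^ (-a) := by
  have ht : Tendsto (fun x : ℝ => -(x : ℂ)) (𝓝[>] 0)
      (𝓝 0 ⊓ 𝓟 (parabolicRegion 0 ρ ∩ negSlitPlane)) := by
    refine tendsto_inf.2 ⟨?_, tendsto_principal.2 ?_⟩
    · have : Continuous fun x : ℝ => -(x : ℂ) := by fun_prop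
      simpa using (this.tendsto 0).mono_left nhdsWithin_le_nhds
    · filter_upwards [self_mem_nhdsWithin] with x hx using neg_mem_slitRegion hρ hx
  refine (hh.zero.comp_tendsto ht).congr' EventuallyEq.rfl ?_
  filter_upwards [self_mem_nhdsWithin] with x hx
  simp [abs_of_pos (Set.mem_Ioi.1 hx)]

theorem PMTSlitAdmissible.isBigO_neg_top {ρ a b : ℝ} {h : ℂ → ℂ}
    (hh : PMTSlitAdmissible ρ a b h) (hρ : 0 ≤ ρ) :
    (fun x : ℝ => h (-(x : ℂ))) =O[atTop] fun x : ℝ => x ^ (-b) := by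
  have ht : Tendsto (fun x : ℝ => -(x : ℂ)) atTop
      (Bornology.cobounded ℂ ⊓ 𝓟 (parabolicRegion 0 ρ ∩ negSlitPlane)) := by
    refine tendsto_inf.2 ⟨?_, tendsto_principal.2 ?_⟩
    · rw [← tendsto_norm_atTop_iff_cobounded]
      simpa using tendsto_abs_atTop_atTop
    · filter_upwards [eventually_gt_atTop 0] with x hx using neg_mem_slitRegion hρ hx
  refine (hh.infty.comp_tendsto ht).congr' EventuallyEq.rfl ?_
  filter_upwards [eventually_gt_atTop 0] with x hx
  simp [abs_of_pos hx]

theorem PMTSlitAdmissible.mellinConvergent {ρ a b : ℝ} {h : ℂ → ℂ}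
    (hh : PMTSlitAdmissible ρ a b h) (hρ : 0 ≤ ρ) {s : ℂ} (ha : a < s.re) (hb : s.re < b) :
    MellinConvergent (fun x : ℝ => h (-(x : ℂ))) s :=
  mellinConvergent_of_isBigO_rpow
    ((hh.continuousOn_neg hρ).locallyIntegrableOn measurableSet_Ioi)
    (hh.isBigO_neg_top hρ) hb (hh.isBigO_neg_zero hρ) ha

theorem parabolicRegion_subset_diff {x σ : ℝ} (hx : 0 < x) (hσ : x ≤ σ) :
    parabolicRegion x σ ⊆ parabolicRegion 0 σ \ {0} := by
  rintro _ ⟨w, hw, rfl⟩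
  simp only [Set.mem_ofPred_eq, Set.uIcc_of_le hσ] at hw
  refine ⟨⟨w, ?_, rfl⟩, fun h => ?_⟩
  · simpa [Set.uIcc_of_le (hx.le.trans hσ)] using ⟨hx.le.trans hw.1, hw.2⟩
  · have : w = 0 := by simpa using h
    rw [this] at hw
    exact absurd hw.1 (by simpa using hx)

theorem PMTAdmissible.pmtConvergent {σ a b : ℝ} {f : ℂ → ℂ} (hf : PMTAdmissible σ a b f)
    (hσ : 0 < σ) {z : ℂ} (hb : z.re + 1 / 2 < b) : PMTConvergent σ f z :=
  pmtConvergent_of_mem (S := Set.uIcc σ σ) (by simp [hσ])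
    (hf.analytic.mono (parabolicRegion_subset_diff hσ le_rfl))
    (hf.infty.mono (inf_le_inf_left _ (principal_mono.2
      ((parabolicRegion_subset_diff hσ le_rfl).trans Set.sdiff_subset)))) hb Set.left_mem_uIcc

/-- The transform is constant in the aperture on `(0, σ]`, hence equal to its limit at `0`. -/
theorem PMTAdmissible.pmt_eq_mellin {σ a b : ℝ} {f : ℂ → ℂ} (hf : PMTAdmissible σ a b f)
    (hσ : 0 < σ) {z : ℂ} (ha : a < z.re + 1 / 2) (hb : z.re + 1 / 2 < b) :
    pmt σ f z = Complex.cos (Real.pi * z) *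
      mellin (fun x : ℝ => f (-(x : ℂ))) (z + 1 / 2) := by
  refine tendsto_nhds_unique ?_ (hf.slitAdmissible.tendsto hσ ha hb).2
  refine tendsto_const_nhds.congr' ?_
  filter_upwards [Ioc_mem_nhdsGT hσ] with x hx
  have hsub := parabolicRegion_subset_diff hx.1 hx.2
  exact (pmt_eq_of_analyticOnNhd hx.1 hσ (hf.analytic.mono hsub)
    (hf.infty.mono (inf_le_inf_left _ (principal_mono.2 (hsub.trans Set.sdiff_subset)))) hb).symm

theorem PMTAdmissible.differentiableOn_pmt {σ a b : ℝ} {f : ℂ → ℂ} (hf : PMTAdmissible σ a b f)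
    (hσ : 0 < σ) : DifferentiableOn ℂ (pmt σ f) {z : ℂ | z.re + 1 / 2 < b} := by
  intro z hz
  obtain ⟨c, hc, hcb⟩ := exists_between (show z.re < b - 1 / 2 by
    have : z.re + 1 / 2 < b := hz
    linarith)
  have h := hf.pmtConvergent hσ (z := (c : ℂ)) (by simp; linarith)
  exact (pmt_hasDerivAt hσ h (by simpa using hc)).2.differentiableAt.differentiableWithinAt

/-! ### Mellin convolution and parabolic convolution -/

/-- By Tonelli: substituting `x ↦ x / y` in the inner integral of norms leaves the constant `N`
times the norm of the Mellin integrand of `φ`. -/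
theorem integrable_mellin_convolution {φ γ : ℝ → ℂ} {s : ℂ} (hφc : ContinuousOn φ (Set.Ioi 0))
    (hγc : ContinuousOn γ (Set.Ioi 0)) (hφ : MellinConvergent φ s) (hγ : MellinConvergent γ s) :
    Integrable (fun p : ℝ × ℝ => (p.2 : ℂ) ^ (s - 1) * (φ p.1 * γ (p.2 / p.1) / (p.1 : ℂ)))
      ((volume.restrict (Set.Ioi 0)).prod (volume.restrict (Set.Ioi 0))) := by
  have hmeas : AEStronglyMeasurable
      (fun p : ℝ × ℝ => (p.2 : ℂ) ^ (s - 1) * (φ p.1 * γ (p.2 / p.1) / (p.1 : ℂ)))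
      ((volume.restrict (Set.Ioi 0)).prod (volume.restrict (Set.Ioi 0))) := by
    rw [Measure.prod_restrict]
    refine ContinuousOn.aestronglyMeasurable ?_ (measurableSet_Ioi.prod measurableSet_Ioi)
    refine ContinuousOn.mul ?_ (ContinuousOn.div (ContinuousOn.mul ?_ ?_) (by fun_prop) ?_)
    · intro p hp
      refine ContinuousAt.continuousWithinAt ?_
      exact (continuousAt_cpow_const (Complex.ofReal_mem_slitPlane.2 hp.2)).comp
        (f := fun p : ℝ × ℝ => (p.2 : ℂ)) (by fun_prop)
    · exact hφc.comp continuousOn_fst fun p hp => hp.1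
    · refine hγc.comp (continuousOn_snd.div continuousOn_fst fun p hp => ?_) fun p hp => ?_
      · exact (Set.mem_Ioi.1 hp.1).ne'
      · exact div_pos (Set.mem_Ioi.1 hp.2) (Set.mem_Ioi.1 hp.1)
    · intro p hp
      exact_mod_cast (Set.mem_Ioi.1 hp.1).ne'
  refine (integrable_prod_iff hmeas).2 ⟨?_, ?_⟩
  · refine (ae_restrict_iff' measurableSet_Ioi).2 (ae_of_all _ fun y hy => ?_)
    have h := (MellinConvergent.comp_mul_left (f := γ) (s := s) (inv_pos.2 hy)).2 hγ
    refine (Integrable.mul_const h (φ y / y)).congr (ae_of_all _ fun x => ?_)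
    simp only [smul_eq_mul, div_eq_mul_inv, mul_comm y⁻¹ x]
    ring
  · set N := ∫ x in Set.Ioi (0 : ℝ), ‖(x : ℂ) ^ (s - 1) • γ x‖
    refine (Integrable.mul_const (Integrable.norm hφ) N).congr ?_
    refine (ae_restrict_iff' measurableSet_Ioi).2 (ae_of_all _ fun y hy => ?_)
    have hy0 : 0 < y := hy
    have h := integral_comp_mul_left_Ioi (fun x : ℝ => ‖(x : ℂ) ^ (s - 1) • γ x‖) 0
      (inv_pos.2 hy0)
    rw [mul_zero, inv_inv] at h
    have hN : N = y⁻¹ * ∫ x in Set.Ioi (0 : ℝ), ‖((y⁻¹ * x : ℝ) : ℂ) ^ (s - 1) • γ (y⁻¹ * x)‖ := by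
      rw [h, smul_eq_mul, inv_mul_cancel_left₀ hy0.ne']
    simp only
    rw [hN, ← integral_const_mul, ← integral_const_mul]
    refine setIntegral_congr_fun measurableSet_Ioi fun x hx => ?_
    have hx0 : 0 < x := hx
    have hyp : 0 < y ^ (s - 1).re := Real.rpow_pos_of_pos hy0 _
    simp only [smul_eq_mul, norm_mul, norm_inv, Complex.norm_real, Real.norm_of_nonneg hy0.le,
      Complex.norm_cpow_eq_rpow_re_of_pos hy0, Complex.norm_cpow_eq_rpow_re_of_pos hx0,
      Complex.norm_cpow_eq_rpow_re_of_pos (mul_pos (inv_pos.2 hy0) hx0),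
      Real.mul_rpow (inv_pos.2 hy0).le hx0.le, Real.inv_rpow hy0.le, div_eq_mul_inv, mul_comm x y⁻¹]
    field_simp

theorem mellin_convolution {φ γ : ℝ → ℂ} {s : ℂ} (hφc : ContinuousOn φ (Set.Ioi 0))
    (hγc : ContinuousOn γ (Set.Ioi 0)) (hφ : MellinConvergent φ s) (hγ : MellinConvergent γ s) :
    mellin (fun x => ∫ y in Set.Ioi (0 : ℝ), φ y * γ (x / y) / (y : ℂ)) s =
      mellin φ s * mellin γ s := by
  have hswap := integral_integral_swap
    (f := fun y x : ℝ => (x : ℂ) ^ (s - 1) * (φ y * γ (x / y) / (y : ℂ)))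
    (integrable_mellin_convolution hφc hγc hφ hγ)
  rw [mellin]
  simp only [smul_eq_mul, ← integral_const_mul]
  rw [← hswap, mellin, ← integral_mul_const]
  refine setIntegral_congr_fun measurableSet_Ioi fun y hy => ?_
  have hy0 : 0 < y := hy
  have hyc : (y : ℂ) ≠ 0 := by exact_mod_cast hy0.ne'
  have h := mellin_comp_mul_left γ s (inv_pos.2 hy0)
  rw [Complex.ofReal_inv, Complex.inv_cpow _ _ (by
    rw [Complex.arg_ofReal_of_nonneg hy0.le]; exact Real.pi_pos.ne), Complex.cpow_neg, inv_inv] at h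
  simp only [smul_eq_mul]
  rw [Complex.cpow_sub _ _ hyc, Complex.cpow_one, show (y : ℂ) ^ s / y * φ y * mellin γ s =
    φ y / y * ((y : ℂ) ^ s • mellin γ s) by rw [smul_eq_mul]; ring, ← h, mellin,
    ← integral_const_mul]
  refine setIntegral_congr_fun measurableSet_Ioi fun x _ => ?_
  simp only [smul_eq_mul, div_eq_mul_inv, mul_comm y⁻¹ x]
  ring

theorem integrableOn_mellin_convolution_kernel {φ γ : ℝ → ℂ} {a₁ b₁ a₂ b₂ : ℝ}
    (hφc : ContinuousOn φ (Set.Ioi 0)) (hγc : ContinuousOn γ (Set.Ioi 0))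
    (hφ0 : φ =O[𝓝[>] 0] fun x => x ^ (-a₁)) (hφi : φ =O[atTop] fun x => x ^ (-b₁))
    (hγ0 : γ =O[𝓝[>] 0] fun x => x ^ (-a₂)) (hγi : γ =O[atTop] fun x => x ^ (-b₂))
    (h12 : a₁ < b₂) (h21 : a₂ < b₁) {x : ℝ} (hx : 0 < x) :
    IntegrableOn (fun y : ℝ => φ y * γ (x / y) / (y : ℂ)) (Set.Ioi 0) := by
  have hpow : ∀ c y : ℝ, 0 < y → (x / y) ^ (-c) = x ^ (-c) * y ^ c := fun c y hy => by
    rw [Real.div_rpow hx.le hy.le, Real.rpow_neg hy.le, div_inv_eq_mul]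
  have hγ0' : (fun y => γ (x / y)) =O[atTop] fun y : ℝ => y ^ a₂ := by
    have ht : Tendsto (fun y : ℝ => x / y) atTop (𝓝[>] 0) := by
      refine tendsto_nhdsWithin_iff.2 ⟨tendsto_const_nhds.div_atTop tendsto_id, ?_⟩
      filter_upwards [eventually_gt_atTop 0] with y hy using div_pos hx hy
    refine (hγ0.comp_tendsto ht).trans (IsBigO.of_bound (x ^ (-a₂)) ?_)
    filter_upwards [eventually_gt_atTop 0] with y hy
    rw [Function.comp_apply, hpow _ _ hy, norm_mul, Real.norm_of_nonneg (by positivity : 0 ≤ x ^ (-a₂))]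
  have hγi' : (fun y => γ (x / y)) =O[𝓝[>] 0] fun y : ℝ => y ^ b₂ := by
    have ht : Tendsto (fun y : ℝ => x / y) (𝓝[>] 0) atTop := by
      simp only [div_eq_mul_inv]
      exact tendsto_inv_nhdsGT_zero.const_mul_atTop hx
    refine (hγi.comp_tendsto ht).trans (IsBigO.of_bound (x ^ (-b₂)) ?_)
    filter_upwards [self_mem_nhdsWithin] with y hy
    rw [Function.comp_apply, hpow _ _ hy, norm_mul, Real.norm_of_nonneg (by positivity : 0 ≤ x ^ (-b₂))]
  have hc : ContinuousOn (fun y => φ y * γ (x / y)) (Set.Ioi 0) := by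
    refine hφc.mul (hγc.comp (continuousOn_const.div continuousOn_id fun y hy => ?_) fun y hy => ?_)
    · exact (Set.mem_Ioi.1 hy).ne'
    · exact div_pos hx hy
  -- The measure `dy / y` is the Mellin weight at `s = 0`. The product is `O(y ^ (b₂ - a₁))` at `0`
  -- and `O(y ^ (a₂ - b₁))` at infinity.
  have key : MellinConvergent (fun y => φ y * γ (x / y)) 0 := by
    refine mellinConvergent_of_isBigO_rpow (a := b₁ - a₂) (b := a₁ - b₂)
      (hc.locallyIntegrableOn measurableSet_Ioi) ((hφi.mul hγ0').congr' EventuallyEq.rfl ?_)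
      (by simpa using h21) ((hφ0.mul hγi').congr' EventuallyEq.rfl ?_) (by simpa using h12)
    · filter_upwards [eventually_gt_atTop 0] with y hy
      rw [← Real.rpow_add hy]; congr 1; ring
    · filter_upwards [self_mem_nhdsWithin] with y hy
      rw [← Real.rpow_add hy]; congr 1; ring
  refine IntegrableOn.congr_fun key (fun y _ => ?_) measurableSet_Ioi
  simp only [zero_sub, Complex.cpow_neg_one, smul_eq_mul]
  ring

theorem pmt_parabolicConv {σ ρ a₁ b₁ a₂ b₂ a₃ b₃ : ℝ} {f g h : ℂ → ℂ} {z : ℂ} (hσ : 0 < σ)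
    (hρ : 0 < ρ) (hf : PMTAdmissible σ a₁ b₁ f) (hg : PMTAdmissible σ a₂ b₂ g)
    (hh : PMTSlitAdmissible ρ a₃ b₃ h)
    (hconv : ∀ x : ℝ, 0 < x → h (-(x : ℂ)) = parabolicConv f g (-(x : ℂ)))
    (h₁ : z.re + 1 / 2 ∈ Set.Ioo a₁ b₁) (h₂ : z.re + 1 / 2 ∈ Set.Ioo a₂ b₂)
    (h₃ : z.re + 1 / 2 ∈ Set.Ioo a₃ b₃) :
    (∀ x : ℝ, 0 < x →
        IntegrableOn (fun y : ℝ => f (-(y : ℂ)) * g (-(x : ℂ) / (y : ℂ)) / (y : ℂ))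
          (Set.Ioi 0)) ∧
      (∀ᶠ ρ' : ℝ in 𝓝[>] 0, PMTConvergent ρ' h z) ∧
      (Complex.cos (Real.pi * z) ≠ 0 →
        Tendsto (fun ρ' : ℝ => pmt ρ' h z) (𝓝[>] 0)
          (𝓝 ((Complex.cos (Real.pi * z))⁻¹ * pmt σ f z * pmt σ g z))) := by
  have hfs := hf.slitAdmissible
  have hgs := hg.slitAdmissible
  have hre : (z + 1 / 2).re = z.re + 1 / 2 := by simp
  have hkern : ∀ x y : ℝ, g (-(x : ℂ) / (y : ℂ)) = g (-((x / y : ℝ) : ℂ)) := fun x y => by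
    push_cast; rw [neg_div]
  obtain ⟨hc, ht⟩ := hh.tendsto hρ h₃.1 h₃.2
  refine ⟨fun x hx => ?_, hc, fun hcos => ?_⟩
  · simp only [hkern]
    exact integrableOn_mellin_convolution_kernel (γ := fun x : ℝ => g (-(x : ℂ)))
      (hfs.continuousOn_neg hσ.le) (hgs.continuousOn_neg hσ.le) (hfs.isBigO_neg_zero hσ.le)
      (hfs.isBigO_neg_top hσ.le) (hgs.isBigO_neg_zero hσ.le) (hgs.isBigO_neg_top hσ.le)
      (h₁.1.trans h₂.2) (h₂.1.trans h₁.2) hx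
  · have hm : mellin (fun x : ℝ => h (-(x : ℂ))) (z + 1 / 2) =
        mellin (fun x : ℝ => f (-(x : ℂ))) (z + 1 / 2) *
          mellin (fun x : ℝ => g (-(x : ℂ))) (z + 1 / 2) := by
      rw [← mellin_convolution (hfs.continuousOn_neg hσ.le) (hgs.continuousOn_neg hσ.le)
        (hfs.mellinConvergent hσ.le (hre ▸ h₁.1) (hre ▸ h₁.2))
        (hgs.mellinConvergent hσ.le (hre ▸ h₂.1) (hre ▸ h₂.2))]
      refine setIntegral_congr_fun measurableSet_Ioi fun x hx => ?_
      simp only [hconv x hx, parabolicConv, hkern]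
    -- The limit carries a single cosine, while each of the two transforms of `f` and `g` carries
    -- its own.
    rw [hm] at ht
    rw [hf.pmt_eq_mellin hσ h₁.1 h₁.2, hg.pmt_eq_mellin hσ h₂.1 h₂.2]
    convert ht using 2
    field_simp

/-! ### Logarithmic coordinates, sectors and rotated rays -/

theorem exp_mul_powerBound_le {a b r t κ : ℝ} (ha : κ ≤ r - a) (hb : κ ≤ b - r) :
    Real.exp (r * t) * powerBound a b (Real.exp t) ≤ Real.exp (-κ * |t|) := by
  have e : ∀ c, Real.exp (r * t) * Real.exp t ^ (-c) = Real.exp ((r - c) * t) := fun c => by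
    rw [← Real.exp_mul, ← Real.exp_add]; congr 1; ring
  simp only [powerBound, Real.exp_le_one_iff]
  split_ifs with h
  · rw [e, Real.exp_le_exp, abs_of_nonpos h]; nlinarith
  · rw [e, Real.exp_le_exp, abs_of_pos (not_le.1 h)]; nlinarith

theorem integrable_exp_neg_mul_abs {κ : ℝ} (hκ : 0 < κ) : Integrable fun t : ℝ => Real.exp (-κ * |t|) :=
  integrable_comp_abs_of_integrableOn_Ioi (f := fun x => Real.exp (-κ * x))
    (exp_neg_integrableOn_Ioi 0 hκ)

theorem tendsto_exp_neg_mul_abs {κ : ℝ} (hκ : 0 < κ) :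
    Tendsto (fun t : ℝ => Real.exp (-κ * |t|)) (cocompact ℝ) (𝓝 0) :=
  Real.tendsto_exp_atBot.comp
    ((tendsto_norm_cocompact_atTop (E := ℝ)).const_mul_atTop_of_neg (neg_lt_zero.2 hκ))

/-- With `x = exp t`, rotating the ray becomes translating the line of integration by an imaginary
amount. -/
theorem mellin_eq_integral_exp (φ : ℝ → ℂ) (s : ℂ) :
    mellin φ s = ∫ t : ℝ, Complex.exp (s * t) * φ (Real.exp t) := by
  rw [mellin, ← Real.range_exp, ← Set.image_univ,
    integral_image_eq_integral_abs_deriv_smul MeasurableSet.univ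
      (fun x _ => (Real.hasDerivAt_exp x).hasDerivWithinAt) Real.exp_injective.injOn,
    setIntegral_univ]
  congr 1; funext t
  have h0 : (Real.exp t : ℂ) ≠ 0 := by exact_mod_cast (Real.exp_pos t).ne'
  rw [abs_of_pos (Real.exp_pos t), Complex.real_smul, smul_eq_mul, ← mul_assoc,
    Complex.cpow_sub _ _ h0, Complex.cpow_one, mul_div_cancel₀ _ h0,
    Complex.cpow_def_of_ne_zero h0, ← Complex.ofReal_log (Real.exp_pos t).le, Real.log_exp,
    mul_comm s]

theorem mellinConvergent_iff_integrable_exp (φ : ℝ → ℂ) (s : ℂ) :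
    MellinConvergent φ s ↔ Integrable fun t : ℝ => Complex.exp (s * t) * φ (Real.exp t) := by
  rw [MellinConvergent, ← Real.range_exp, ← Set.image_univ,
    integrableOn_image_iff_integrableOn_abs_deriv_smul MeasurableSet.univ
      (fun x _ => (Real.hasDerivAt_exp x).hasDerivWithinAt) Real.exp_injective.injOn,
    integrableOn_univ]
  refine integrable_congr (ae_of_all _ fun t => ?_)
  have h0 : (Real.exp t : ℂ) ≠ 0 := by exact_mod_cast (Real.exp_pos t).ne'
  simp only
  rw [abs_of_pos (Real.exp_pos t), Complex.real_smul, smul_eq_mul, ← mul_assoc,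
    Complex.cpow_sub _ _ h0, Complex.cpow_one, mul_div_cancel₀ _ h0,
    Complex.cpow_def_of_ne_zero h0, ← Complex.ofReal_log (Real.exp_pos t).le, Real.log_exp,
    mul_comm s]

theorem neg_exp_mem_negSector {θ : ℝ} (hθ : θ ≤ Real.pi) {ζ : ℂ} (h : |ζ.im| < θ) :
    -Complex.exp ζ ∈ negSector θ := by
  refine ⟨neg_ne_zero.2 (Complex.exp_ne_zero _), ?_⟩
  have h' := abs_lt.1 (h.trans_le hθ)
  rwa [neg_neg, Complex.arg_exp, (toIocMod_eq_self Real.two_pi_pos).2 ⟨h'.1, by linarith [h'.2]⟩]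

theorem isOpen_negSector {θ : ℝ} (hθ : θ ≤ Real.pi) : IsOpen (negSector θ) := by
  rw [isOpen_iff_mem_nhds]
  rintro u ⟨hu, harg⟩
  have hs : -u ∈ Complex.slitPlane :=
    Complex.mem_slitPlane_iff_arg.2 ⟨fun h => by
      rw [h, abs_of_pos Real.pi_pos] at harg; linarith, neg_ne_zero.2 hu⟩
  have hc : ContinuousAt (fun u : ℂ => |(-u).arg|) u :=
    ((Complex.continuousAt_arg hs).comp (f := fun u : ℂ => -u) continuousAt_neg).abs
  filter_upwards [hc.eventually_lt continuousAt_const harg, isOpen_ne.mem_nhds hu] with v h1 h2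
  exact ⟨h2, h1⟩

theorem exists_bound_negSector {f : ℂ → ℂ} {a b θ ψ : ℝ} (hθ : θ ≤ Real.pi)
    (h0 : f =O[𝓝[≠] 0] fun u : ℂ => ‖u‖ ^ (-a)) (hf : DifferentiableOn ℂ f (negSector θ))
    (hi : f =O[Bornology.cobounded ℂ ⊓ 𝓟 (negSector ψ)] fun u : ℂ => ‖u‖ ^ (-b)) (hψ : ψ < θ) :
    ∃ C, 0 ≤ C ∧ ∀ u ∈ negSector ψ, ‖f u‖ ≤ C * powerBound a b ‖u‖ := by
  obtain ⟨C₀, r, hr, hr1, hC₀⟩ := exists_bound_near_zero h0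
  refine exists_powerBound hr hr1 (fun h => h.1 rfl) (fun u hu => hC₀ u hu.1) hi fun R => ?_
  -- In logarithmic coordinates the truncated sector lies in the image of a compact rectangle; `ψ <
  -- θ` keeps its closed edges inside the domain of holomorphy.
  have hcont : ContinuousOn (fun ζ : ℂ => f (-Complex.exp ζ))
      (Set.Icc (Real.log r) (Real.log R) ×ℂ Set.Icc (-ψ) ψ) := by
    intro ζ hζ
    have hmem : -Complex.exp ζ ∈ negSector θ :=
      neg_exp_mem_negSector hθ ((abs_le.2 hζ.2).trans_lt hψ)
    have := ((hf.differentiableAt ((isOpen_negSector hθ).mem_nhds hmem)).continuousAt)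
    exact (this.comp (f := fun ζ : ℂ => -Complex.exp ζ) (by fun_prop)).continuousWithinAt
  obtain ⟨M, hM⟩ := (isCompact_Icc.reProdIm isCompact_Icc).exists_bound_of_continuousOn hcont
  refine ⟨M, fun u hu h1 h2 => ?_⟩
  have hne : -u ≠ 0 := neg_ne_zero.2 hu.1
  have hpos : 0 < ‖u‖ := norm_pos_iff.2 hu.1
  have := hM (Complex.log (-u)) ⟨?_, ?_⟩
  · rwa [Complex.exp_log hne, neg_neg] at this
  · simp only [Set.mem_preimage, Complex.log_re, norm_neg]
    exact ⟨Real.log_le_log hr h1, Real.log_le_log hpos h2⟩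
  · simp only [Set.mem_preimage, Complex.log_im]
    exact abs_le.1 hu.2.le

/-- The restriction of `f` to the ray of argument `π + β`. -/
noncomputable def negRay (f : ℂ → ℂ) (β x : ℝ) : ℂ := f (-(x * Complex.exp (β * Complex.I)))

section Rotation

variable {f : ℂ → ℂ} {a b θ ψ C : ℝ}

theorem norm_exp_mul_negRay_le (hθ : θ ≤ Real.pi) (hψ : ψ ≤ θ) (hC : 0 ≤ C)
    (hb : ∀ u ∈ negSector ψ, ‖f u‖ ≤ C * powerBound a b ‖u‖) {κ r : ℝ} (hκa : κ ≤ r - a)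
    (hκb : κ ≤ b - r) {β : ℝ} (hβ : |β| < ψ) (t : ℝ) :
    Real.exp (r * t) * ‖f (-Complex.exp (t + β * Complex.I))‖ ≤ C * Real.exp (-κ * |t|) := by
  have h := hb (-Complex.exp (t + β * Complex.I))
    (neg_exp_mem_negSector (hψ.trans hθ) (by simpa using hβ))
  have hn : ‖-Complex.exp (t + β * Complex.I)‖ = Real.exp t := by simp [Complex.norm_exp]
  rw [hn] at h
  calc _ ≤ Real.exp (r * t) * (C * powerBound a b (Real.exp t)) := by gcongr
    _ = C * (Real.exp (r * t) * powerBound a b (Real.exp t)) := by ring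
    _ ≤ _ := by gcongr; exact exp_mul_powerBound_le hκa hκb

theorem negRay_exp (f : ℂ → ℂ) (β t : ℝ) :
    negRay f β (Real.exp t) = f (-Complex.exp (t + β * Complex.I)) := by
  rw [negRay, Complex.ofReal_exp, ← Complex.exp_add]

theorem continuous_comp_neg_exp (hθ : θ ≤ Real.pi) (hf : DifferentiableOn ℂ f (negSector θ)) {β : ℝ}
    (hβ : |β| < θ) : Continuous fun t : ℝ => f (-Complex.exp (t + β * Complex.I)) := by
  refine hf.continuousOn.comp_continuous (by fun_prop) fun t => ?_
  exact neg_exp_mem_negSector hθ (by simpa using hβ)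

theorem mellinConvergent_negRay (hθ : θ ≤ Real.pi) (hf : DifferentiableOn ℂ f (negSector θ))
    (hψ : ψ ≤ θ) (hC : 0 ≤ C) (hb : ∀ u ∈ negSector ψ, ‖f u‖ ≤ C * powerBound a b ‖u‖) {s : ℂ}
    (hsa : a < s.re) (hsb : s.re < b) {β : ℝ} (hβ : |β| < ψ) :
    MellinConvergent (negRay f β) s := by
  rw [mellinConvergent_iff_integrable_exp]
  simp only [negRay_exp]
  have hκ : 0 < min (s.re - a) (b - s.re) := lt_min (by linarith) (by linarith)
  refine ((integrable_exp_neg_mul_abs hκ).const_mul C).mono'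
    (((by fun_prop : Continuous fun t : ℝ => Complex.exp (s * t)).mul
      (continuous_comp_neg_exp hθ hf (hβ.trans_le hψ))).aestronglyMeasurable) (ae_of_all _ fun t => ?_)
  rw [norm_mul, Complex.norm_exp, show (s * (t : ℂ)).re = s.re * t by simp]
  exact norm_exp_mul_negRay_le hθ hψ hC hb (min_le_left _ _) (min_le_right _ _) hβ t

/-- The bound on `f` depends only on `‖u‖`, so one `M` serves every angle and every height; this
uniformity later yields exponential decay. -/
theorem exists_norm_mellin_negRay_le (hθ : θ ≤ Real.pi)
    (hψ : ψ ≤ θ) (hC : 0 ≤ C) (hb : ∀ u ∈ negSector ψ, ‖f u‖ ≤ C * powerBound a b ‖u‖) {r : ℝ}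
    (hra : a < r) (hrb : r < b) :
    ∃ M, ∀ β : ℝ, |β| < ψ → ∀ s : ℂ, s.re = r → ‖mellin (negRay f β) s‖ ≤ M := by
  have hκ : 0 < min (r - a) (b - r) := lt_min (by linarith) (by linarith)
  refine ⟨∫ t : ℝ, C * Real.exp (-(min (r - a) (b - r)) * |t|), fun β hβ s hs => ?_⟩
  rw [mellin_eq_integral_exp]
  simp only [negRay_exp]
  refine norm_integral_le_of_norm_le ((integrable_exp_neg_mul_abs hκ).const_mul C)
    (ae_of_all _ fun t => ?_)
  rw [norm_mul, Complex.norm_exp, show (s * (t : ℂ)).re = r * t by simp [hs]]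
  exact norm_exp_mul_negRay_le hθ hψ hC hb (min_le_left _ _) (min_le_right _ _) hβ t

theorem mellin_negRay (hθ : θ ≤ Real.pi) (hf : DifferentiableOn ℂ f (negSector θ)) (hψ : ψ ≤ θ)
    (hC : 0 ≤ C) (hb : ∀ u ∈ negSector ψ, ‖f u‖ ≤ C * powerBound a b ‖u‖) {s : ℂ}
    (hsa : a < s.re) (hsb : s.re < b) {β : ℝ} (hβ : |β| < ψ) :
    mellin (negRay f β) s =
      Complex.exp (-(β * Complex.I * s)) * mellin (fun x : ℝ => f (-(x : ℂ))) s := by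
  set κ := min (s.re - a) (b - s.re)
  have hκ : 0 < κ := lt_min (by linarith) (by linarith)
  -- The factor `-I` turns horizontal lines into vertical ones, so that `integral_vertical_eq`
  -- applies; the ray of angle `β` corresponds to `Re w = -β`.
  set F : ℂ → ℂ := fun w =>
    Complex.exp (s * (-Complex.I * w)) * f (-Complex.exp (-Complex.I * w))
  have habs : ∀ x ∈ Set.uIcc 0 (-β), |x| ≤ |β| := fun x hx => by
    simpa using Set.abs_sub_left_of_mem_uIcc hx
  have him : ∀ w : ℂ, (-Complex.I * w).im = -w.re := fun w => by simp
  have hF : DifferentiableOn ℂ F {w | w.re ∈ Set.uIcc 0 (-β)} := by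
    intro w hw
    have hmem : -Complex.exp (-Complex.I * w) ∈ negSector θ :=
      neg_exp_mem_negSector hθ (by
        rw [him, abs_neg]; exact (habs _ hw).trans_lt (hβ.trans_le hψ))
    have h1 := hf.differentiableAt ((isOpen_negSector hθ).mem_nhds hmem)
    have h2 : DifferentiableAt ℂ (fun w : ℂ => -Complex.exp (-Complex.I * w)) w := by fun_prop
    have h3 : DifferentiableAt ℂ (fun w : ℂ => Complex.exp (s * (-Complex.I * w))) w := by fun_prop
    exact (h3.mul (h1.comp (f := fun w : ℂ => -Complex.exp (-Complex.I * w)) w h2)).differentiableWithinAt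
  have hlin : ∀ x y : ℝ, -Complex.I * ((x : ℂ) + y * Complex.I) = y + ((-x : ℝ) : ℂ) * Complex.I := by
    intro x y
    push_cast
    linear_combination -(y : ℂ) * Complex.I_mul_I
  have hB : ∀ y x : ℝ, x ∈ Set.uIcc 0 (-β) → ‖F (x + y * Complex.I)‖ ≤
      Real.exp (|s.im| * |β|) * C * Real.exp (-κ * |y|) := by
    intro y x hx
    simp only [F]
    rw [norm_mul, hlin, Complex.norm_exp]
    have h1 := norm_exp_mul_negRay_le hθ hψ hC hb (min_le_left _ _ : κ ≤ s.re - a)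
      (min_le_right _ _) (β := -x) (by rw [abs_neg]; exact (habs x hx).trans_lt hβ) y
    have h2 : (s * ((y : ℂ) + ((-x : ℝ) : ℂ) * Complex.I)).re = s.re * y + s.im * x := by
      simp
    have h3 : s.im * x ≤ |s.im| * |β| := (le_abs_self _).trans (by
      rw [abs_mul]; exact mul_le_mul_of_nonneg_left (habs x hx) (abs_nonneg _))
    rw [h2, add_comm, Real.exp_add, mul_assoc, mul_assoc]
    gcongr
  have key := integral_vertical_eq (B := fun y => Real.exp (|s.im| * |β|) * C * Real.exp (-κ * |y|))
    hF (by simpa using (tendsto_exp_neg_mul_abs hκ).const_mul (Real.exp (|s.im| * |β|) * C))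
    ((integrable_exp_neg_mul_abs hκ).const_mul _) (Eventually.of_forall hB)
  rw [mellin_eq_integral_exp, mellin_eq_integral_exp]
  have e0 : ∀ t : ℝ, Complex.exp (s * t) * f (-((Real.exp t : ℝ) : ℂ)) =
      F ((0 : ℝ) + t * Complex.I) := fun t => by
    simp only [F, hlin]; simp
  have e1 : ∀ t : ℝ, Complex.exp (s * t) * negRay f β (Real.exp t) =
      Complex.exp (-(β * Complex.I * s)) * F ((-β : ℝ) + t * Complex.I) := fun t => by
    simp only [F, hlin, negRay_exp, neg_neg]
    rw [← mul_assoc, ← Complex.exp_add]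
    congr 2; ring
  simp only [e0, e1]
  rw [integral_const_mul, key]

end Rotation

/-! ### Inversion -/

theorem cos_pi_mul_vertical_ne_zero (γ : ℝ) {τ : ℝ} (hτ : τ ≠ 0) :
    Complex.cos (Real.pi * (γ + τ * Complex.I)) ≠ 0 := by
  intro h
  obtain ⟨k, hk⟩ := Complex.cos_eq_zero_iff.1 h
  have := congrArg Complex.im hk
  rw [show (2 * (k : ℂ) + 1) * Real.pi / 2 = (((2 * k + 1) * Real.pi / 2 : ℝ) : ℂ) by
    push_cast; ring, Complex.ofReal_im] at this
  simp [Real.pi_ne_zero, hτ] at this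

theorem cpow_neg_polar {v : ℂ} (hv : v ≠ 0) (s : ℂ) :
    v ^ (-s) = (‖v‖ : ℂ) ^ (-s) * Complex.exp (-(v.arg * Complex.I * s)) := by
  have hn : 0 < ‖v‖ := norm_pos_iff.2 hv
  have hn' : (‖v‖ : ℂ) ≠ 0 := by exact_mod_cast hn.ne'
  rw [Complex.cpow_def_of_ne_zero hv, Complex.cpow_def_of_ne_zero hn', ← Complex.exp_add,
    Complex.log, Complex.ofReal_log hn.le]
  congr 1; ring

/-- Choose `η` with `|β| < η < ψ`. Rotation by `±η`, with the sign of `τ`, shows that the unrotated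
transform is `O(exp (-η |τ|))`; rotating by `β` costs at most `exp (|β| |τ|)`. -/
theorem verticalIntegrable_mellin_negRay {f : ℂ → ℂ} {a b θ ψ C : ℝ} (hθ : θ ≤ Real.pi)
    (hf : DifferentiableOn ℂ f (negSector θ)) (hψ : ψ ≤ θ) (hC : 0 ≤ C)
    (hb : ∀ u ∈ negSector ψ, ‖f u‖ ≤ C * powerBound a b ‖u‖) {r : ℝ} (hra : a < r) (hrb : r < b)
    (hcont : Continuous fun τ : ℝ => mellin (fun x : ℝ => f (-(x : ℂ))) (r + τ * Complex.I))
    {β : ℝ} (hβ : |β| < ψ) :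
    Complex.VerticalIntegrable (mellin (negRay f β)) r := by
  obtain ⟨η, hβη, hηψ⟩ := exists_between hβ
  have hη0 : 0 ≤ η := (abs_nonneg β).trans hβη.le
  obtain ⟨M, hM⟩ := exists_norm_mellin_negRay_le hθ hψ hC hb hra hrb
  have hrot : ∀ (δ τ : ℝ), |δ| < ψ → mellin (negRay f δ) (r + τ * Complex.I) =
      Complex.exp (-(δ * Complex.I * (r + τ * Complex.I))) *
        mellin (fun x : ℝ => f (-(x : ℂ))) (r + τ * Complex.I) := fun δ τ hδ =>
    mellin_negRay hθ hf hψ hC hb (by simpa using hra) (by simpa using hrb) hδ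
  have hnorm : ∀ δ τ : ℝ, ‖Complex.exp (-(δ * Complex.I * (r + τ * Complex.I)))‖ =
      Real.exp (δ * τ) := fun δ τ => by rw [Complex.norm_exp]; simp
  have hdecay : ∀ δ τ : ℝ, |δ| < ψ →
      ‖mellin (fun x : ℝ => f (-(x : ℂ))) (r + τ * Complex.I)‖ ≤ M * Real.exp (-(δ * τ)) := by
    intro δ τ hδ
    have h := hM δ hδ (r + τ * Complex.I) (by simp)
    rw [hrot δ τ hδ, norm_mul, hnorm] at h
    rw [Real.exp_neg, ← div_eq_mul_inv, le_div_iff₀ (Real.exp_pos _), mul_comm]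
    exact h
  have hηabs : |η| < ψ := by rwa [abs_of_nonneg hη0]
  have hdecay' : ∀ τ : ℝ, ‖mellin (fun x : ℝ => f (-(x : ℂ))) (r + τ * Complex.I)‖ ≤
      M * Real.exp (-(η * |τ|)) := by
    intro τ
    rcases le_total 0 τ with h | h
    · rw [abs_of_nonneg h]; exact hdecay η τ hηabs
    · rw [abs_of_nonpos h]
      have := hdecay (-η) τ (by rwa [abs_neg])
      rwa [neg_mul, ← mul_neg] at this
  have hM0 : 0 ≤ M := (norm_nonneg _).trans (hM β hβ r (by simp))
  refine ((integrable_exp_neg_mul_abs (sub_pos.2 hβη)).const_mul M).mono' ?_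
    (ae_of_all _ fun τ => ?_)
  · refine Continuous.aestronglyMeasurable ?_
    simp only [hrot β _ hβ]
    exact (by fun_prop : Continuous fun τ : ℝ =>
      Complex.exp (-(β * Complex.I * (r + τ * Complex.I)))).mul hcont
  · rw [hrot β τ hβ, norm_mul, hnorm]
    calc _ ≤ Real.exp (|β| * |τ|) * (M * Real.exp (-(η * |τ|))) := by
          refine mul_le_mul (Real.exp_le_exp.2 ?_) (hdecay' τ) (norm_nonneg _) (Real.exp_pos _).le
          exact (le_abs_self _).trans (abs_mul _ _).le
      _ = M * (Real.exp (|β| * |τ|) * Real.exp (-(η * |τ|))) := by ring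
      _ = _ := by rw [← Real.exp_add]; congr 2; ring

theorem pmt_inversion {σ a b θ γ : ℝ} {f : ℂ → ℂ} (hσ : 0 < σ) (hf : PMTAdmissible σ a b f)
    (hθ : θ ≤ Real.pi) (hd : DifferentiableOn ℂ f (negSector θ))
    (hi : ∀ ψ : ℝ, 0 < ψ → ψ < θ →
      f =O[Bornology.cobounded ℂ ⊓ 𝓟 (negSector ψ)] fun u : ℂ => ‖u‖ ^ (-b))
    (ha : a < γ + 1 / 2) (hb : γ + 1 / 2 < b) {u : ℂ} (hu : u ∈ negSector θ) :
    Integrable (fun τ : ℝ =>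
        pmt σ f (γ + τ * Complex.I) * (Complex.cos (Real.pi * (γ + τ * Complex.I)))⁻¹ *
          (-u) ^ (-((γ + τ * Complex.I : ℂ) + 1 / 2))) ∧
      f u = 1 / (2 * Real.pi) * ∫ τ : ℝ,
        pmt σ f (γ + τ * Complex.I) * (Complex.cos (Real.pi * (γ + τ * Complex.I)))⁻¹ *
          (-u) ^ (-((γ + τ * Complex.I : ℂ) + 1 / 2)) := by
  have hfs := hf.slitAdmissible
  set β := (-u).arg
  set r := γ + 1 / 2 with hr
  obtain ⟨ψ, hβψ, hψθ⟩ := exists_between (show |β| < θ from hu.2)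
  have hψ0 : 0 < ψ := (abs_nonneg β).trans_lt hβψ
  obtain ⟨C, hC, hbd⟩ := exists_bound_negSector hθ hf.zero hd (hi ψ hψ0 hψθ) hψθ
  have hu0 : -u ≠ 0 := neg_ne_zero.2 hu.1
  have hn : 0 < ‖-u‖ := norm_pos_iff.2 hu0
  have hcont : Continuous fun τ : ℝ =>
      mellin (fun x : ℝ => f (-(x : ℂ))) (r + τ * Complex.I) := by
    refine continuous_iff_continuousAt.2 fun τ => ?_
    refine ContinuousAt.comp (f := fun τ : ℝ => (r : ℂ) + τ * Complex.I)
      (g := mellin fun x : ℝ => f (-(x : ℂ))) ?_ (by fun_prop)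
    exact (mellin_differentiableAt_of_isBigO_rpow
      ((hfs.continuousOn_neg hσ.le).locallyIntegrableOn measurableSet_Ioi)
      (hfs.isBigO_neg_top hσ.le) (by simpa using hb) (hfs.isBigO_neg_zero hσ.le)
      (by simpa using ha)).continuousAt
  have hV := verticalIntegrable_mellin_negRay hθ hd hψθ.le hC hbd ha hb hcont hβψ
  have hpol : negRay f β ‖-u‖ = f u := by
    rw [negRay, Complex.norm_mul_exp_arg_mul_I, neg_neg]
  have hray : ContinuousAt (negRay f β) ‖-u‖ := by
    have hfu : ContinuousAt f (-((‖-u‖ : ℂ) * Complex.exp (β * Complex.I))) := by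
      rw [Complex.norm_mul_exp_arg_mul_I, neg_neg]
      exact (hd.differentiableAt ((isOpen_negSector hθ).mem_nhds hu)).continuousAt
    exact hfu.comp (f := fun x : ℝ => -((x : ℂ) * Complex.exp (β * Complex.I))) (by fun_prop)
  have hinv := mellinInv_mellin_eq r (negRay f β) hn
    (mellinConvergent_negRay hθ hd hψθ.le hC hbd (by simpa using ha) (by simpa using hb) hβψ)
    hV hray
  -- The cosines cancel except possibly at `τ = 0`, since zeros of `cos` are real. The angular
  -- factor of `(-u) ^ (-s)` is exactly the one that rotates the Mellin transform to the ray through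
  -- `u`.
  have hae : (fun τ : ℝ =>
      pmt σ f (γ + τ * Complex.I) * (Complex.cos (Real.pi * (γ + τ * Complex.I)))⁻¹ *
        (-u) ^ (-((γ + τ * Complex.I : ℂ) + 1 / 2))) =ᵐ[volume]
      fun τ : ℝ => (‖-u‖ : ℂ) ^ (-(r + τ * Complex.I)) *
        mellin (negRay f β) (r + τ * Complex.I) := by
    filter_upwards [ae_real_ne_zero] with τ hτ
    have hs : (γ + τ * Complex.I : ℂ) + 1 / 2 = r + τ * Complex.I := by
      rw [hr]; push_cast; ring
    rw [hf.pmt_eq_mellin hσ (by simpa [r] using ha) (by simpa [r] using hb),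
      mellin_negRay hθ hd hψθ.le hC hbd (by simpa using ha) (by simpa using hb) hβψ,
      cpow_neg_polar hu0, hs, mul_comm (Complex.cos _),
      mul_inv_cancel_right₀ (cos_pi_mul_vertical_ne_zero γ hτ)]
    ring
  refine ⟨Integrable.congr ?_ hae.symm, ?_⟩
  · refine Integrable.bdd_mul hV ?_ (c := ‖-u‖ ^ (-r)) (ae_of_all _ fun τ => ?_)
    · refine Continuous.aestronglyMeasurable ?_
      exact Continuous.const_cpow (by fun_prop) (Or.inl (by exact_mod_cast hn.ne'))
    · rw [Complex.norm_cpow_eq_rpow_re_of_pos hn]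
      simp
  · rw [integral_congr_ae hae, ← hpol, ← hinv, mellinInv, Complex.real_smul]
    push_cast
    rfl

/-! ### Admissibility of the exponential and of power series in it -/

theorem MeromorphicAt.exists_isBigO_norm_rpow {f : ℂ → ℂ} (hf : MeromorphicAt f 0) :
    ∃ a : ℝ, f =O[𝓝[≠] 0] fun u : ℂ => ‖u‖ ^ (-a) := by
  obtain ⟨n, hn⟩ := hf
  refine ⟨n, ?_⟩
  obtain ⟨c, hc⟩ := (hn.continuousAt.isBigO_one ℝ).bound
  refine IsBigO.of_bound c ?_
  filter_upwards [nhdsWithin_le_nhds hc, self_mem_nhdsWithin] with u hu hne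
  have hpos : 0 < ‖u‖ := norm_pos_iff.2 hne
  rw [Real.norm_of_nonneg (by positivity), Real.rpow_neg hpos.le, Real.rpow_natCast,
    ← div_eq_mul_inv, le_div_iff₀ (by positivity), mul_comm]
  simpa [norm_smul] using hu

theorem tendsto_norm_cobounded_inf (T : Set ℂ) :
    Tendsto (fun u : ℂ => ‖u‖) (Bornology.cobounded ℂ ⊓ 𝓟 T) atTop :=
  tendsto_norm_cobounded_atTop.mono_left inf_le_left

/-- For `u = w ^ 2`, `Re u = 2 (Re w) ^ 2 - ‖u‖`, and `Re w ≤ σ`. -/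
theorem norm_exp_le_of_mem_parabolicRegion {σ : ℝ} (hσ : 0 ≤ σ) {u : ℂ}
    (hu : u ∈ parabolicRegion 0 σ) :
    ‖Complex.exp u‖ ≤ Real.exp (2 * σ ^ 2) * Real.exp (-1 * ‖u‖) := by
  obtain ⟨w, hw, rfl⟩ := hu
  simp only [Set.mem_ofPred_eq, Set.uIcc_of_le hσ] at hw
  rw [Complex.norm_exp, ← Real.exp_add, Real.exp_le_exp, norm_pow, ← Complex.normSq_eq_norm_sq,
    Complex.normSq_apply]
  have : (w ^ 2).re = w.re * w.re - w.im * w.im := by rw [pow_two, Complex.mul_re]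
  rw [show ((fun w : ℂ => w ^ 2) w).re = _ from this]
  nlinarith [hw.1, hw.2]

theorem isBigO_exp_parabolicRegion {σ : ℝ} (hσ : 0 ≤ σ) (b : ℝ) :
    Complex.exp =O[Bornology.cobounded ℂ ⊓ 𝓟 (parabolicRegion 0 σ)] fun u : ℂ => ‖u‖ ^ (-b) := by
  have h1 : Complex.exp =O[Bornology.cobounded ℂ ⊓ 𝓟 (parabolicRegion 0 σ)]
      fun u : ℂ => Real.exp (-1 * ‖u‖) := by
    refine IsBigO.of_bound (Real.exp (2 * σ ^ 2)) ?_
    filter_upwards [mem_inf_of_right (mem_principal_self _)] with u hu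
    rw [Real.norm_of_nonneg (Real.exp_pos _).le]
    exact norm_exp_le_of_mem_parabolicRegion hσ hu
  exact h1.trans ((isLittleO_exp_neg_mul_rpow_atTop one_pos (-b)).isBigO.comp_tendsto
    (tendsto_norm_cobounded_inf _))

theorem pmtAdmissible_exp {σ : ℝ} (hσ : 0 ≤ σ) (b : ℝ) : PMTAdmissible σ 0 b Complex.exp where
  analytic := fun u _ => Complex.differentiable_exp.analyticAt u
  zero := by
    simpa using (Complex.continuous_exp.continuousAt.isBigO_one ℝ).mono nhdsWithin_le_nhds
  infty := isBigO_exp_parabolicRegion hσ b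

section Composition

variable {σ : ℝ} {a : ℕ → ℂ} {g : ℂ → ℂ}

theorem isBigO_powerSeries (hg : ∀ q : ℂ, ‖q‖ < 1 →
    HasSum (fun n : ℕ => a (n + 1) * q ^ (n + 1)) (g q)) : g =O[𝓝 0] fun q : ℂ => q := by
  have hs : Summable fun n : ℕ => ‖a (n + 1) * (1 / 2 : ℂ) ^ (n + 1)‖ :=
    summable_norm_iff.2 (hg (1 / 2) (by norm_num)).summable
  -- Comparison with the series at `q = 1/2`: one factor `q` is taken out, and the `2` makes up for
  -- the matching factor `1/2`.
  refine IsBigO.of_bound (2 * ∑' n : ℕ, ‖a (n + 1) * (1 / 2 : ℂ) ^ (n + 1)‖) ?_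
  filter_upwards [Metric.ball_mem_nhds (0 : ℂ) (by norm_num : (0 : ℝ) < 1 / 2)] with q hq
  have hq' : ‖q‖ < 1 / 2 := by simpa using hq
  rw [← (hg q (by linarith)).tsum_eq]
  refine tsum_of_norm_bounded (g := fun n : ℕ =>
    (2 * ‖a (n + 1) * (1 / 2 : ℂ) ^ (n + 1)‖) * ‖q‖) ?_ fun n => ?_
  · exact (hs.hasSum.mul_left 2).mul_right ‖q‖
  · rw [norm_mul, norm_mul, norm_pow, norm_pow, pow_succ, pow_succ]
    have h1 : ‖q‖ ^ n ≤ ‖(1 / 2 : ℂ)‖ ^ n := by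
      gcongr; exact hq'.le.trans (by norm_num)
    have h2 : ‖(1 / 2 : ℂ)‖ = 1 / 2 := by norm_num
    calc ‖a (n + 1)‖ * (‖q‖ ^ n * ‖q‖) ≤ ‖a (n + 1)‖ * (‖(1 / 2 : ℂ)‖ ^ n * ‖q‖) := by gcongr
      _ = _ := by rw [h2]; ring

theorem exists_pmtAdmissible_comp_exp (hσ : 0 ≤ σ)
    (hg : ∀ q : ℂ, ‖q‖ < 1 → HasSum (fun n : ℕ => a (n + 1) * q ^ (n + 1)) (g q))
    (hana : AnalyticOnNhd ℂ (fun u => g (Complex.exp u)) (parabolicRegion 0 σ \ {0}))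
    (hmer : MeromorphicAt (fun u => g (Complex.exp u)) 0) :
    ∃ c : ℝ, ∀ b : ℝ, PMTAdmissible σ c b fun u => g (Complex.exp u) := by
  obtain ⟨c, hc⟩ := hmer.exists_isBigO_norm_rpow
  refine ⟨c, fun b => ⟨hana, hc, ?_⟩⟩
  have ht : Tendsto Complex.exp (Bornology.cobounded ℂ ⊓ 𝓟 (parabolicRegion 0 σ)) (𝓝 0) := by
    refine (isBigO_exp_parabolicRegion hσ 1).trans_tendsto ?_
    exact (tendsto_rpow_neg_atTop one_pos).comp (tendsto_norm_cobounded_inf _)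
  exact ((isBigO_powerSeries hg).comp_tendsto ht).trans (isBigO_exp_parabolicRegion hσ b)

end Composition

/-! ### Summation by parts and Abel's limit theorem -/

section AbelSummation

/-- The partial sums of the Dirichlet series of `a` at `s`. -/
noncomputable def dirichletPartialSum (a : ℕ → ℂ) (s : ℂ) (N : ℕ) : ℂ :=
  ∑ n ∈ Finset.Icc 1 N, a n * (n : ℂ) ^ (-s)

theorem dirichletPartialSum_succ (a : ℕ → ℂ) (s : ℂ) (N : ℕ) :
    dirichletPartialSum a s (N + 1) =
      dirichletPartialSum a s N + a (N + 1) * ((N + 1 : ℕ) : ℂ) ^ (-s) :=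
  Finset.sum_Icc_succ_top (by omega) _

/-- The differences `(n + 1) ^ (-δ) - (n + 2) ^ (-δ)`. -/
noncomputable def cpowDiff (δ : ℂ) (n : ℕ) : ℂ :=
  ((n + 1 : ℕ) : ℂ) ^ (-δ) - ((n + 2 : ℕ) : ℂ) ^ (-δ)

theorem sum_range_dirichlet_eq (a : ℕ → ℂ) (s δ : ℂ) (N : ℕ) :
    ∑ n ∈ Finset.range N, a (n + 1) * ((n + 1 : ℕ) : ℂ) ^ (-(s + δ)) =
      dirichletPartialSum a s N * ((N + 1 : ℕ) : ℂ) ^ (-δ) +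
        ∑ n ∈ Finset.range N, dirichletPartialSum a s (n + 1) * cpowDiff δ n := by
  induction N with
  | zero => simp [dirichletPartialSum]
  | succ N ih =>
    have h : ((N + 1 : ℕ) : ℂ) ≠ 0 := by exact_mod_cast N.succ_ne_zero
    rw [Finset.sum_range_succ, Finset.sum_range_succ, ih, dirichletPartialSum_succ, neg_add,
      Complex.cpow_add _ _ h, cpowDiff]
    ring

/-- Mean value inequality for `x ^ (-δ)` on an interval of length `1`, where the derivative is
largest at the left end. -/
theorem norm_cpowDiff_le {δ : ℂ} (hδ : 0 ≤ δ.re) (n : ℕ) :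
    ‖cpowDiff δ n‖ ≤ ‖δ‖ * ((n + 1 : ℕ) : ℝ) ^ (-δ.re - 1) := by
  have hn : (0 : ℝ) < ((n + 1 : ℕ) : ℝ) := by positivity
  have hder : ∀ x ∈ Set.Icc ((n + 1 : ℕ) : ℝ) ((n + 2 : ℕ) : ℝ),
      HasDerivWithinAt (fun x : ℝ => (x : ℂ) ^ (-δ)) (-δ * (x : ℂ) ^ (-δ - 1))
        (Set.Icc ((n + 1 : ℕ) : ℝ) ((n + 2 : ℕ) : ℝ)) x := fun x hx => by
    have h := ((hasDerivAt_id (x : ℂ)).cpow_const (c := -δ)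
      (Complex.ofReal_mem_slitPlane.2 (hn.trans_le hx.1))).comp_ofReal
    simpa using h.hasDerivWithinAt
  have hbd : ∀ x ∈ Set.Icc ((n + 1 : ℕ) : ℝ) ((n + 2 : ℕ) : ℝ),
      ‖-δ * (x : ℂ) ^ (-δ - 1)‖ ≤ ‖δ‖ * ((n + 1 : ℕ) : ℝ) ^ (-δ.re - 1) := fun x hx => by
    rw [norm_mul, norm_neg, Complex.norm_cpow_eq_rpow_re_of_pos (hn.trans_le hx.1)]
    gcongr
    simp only [Complex.sub_re, Complex.neg_re, Complex.one_re]
    exact Real.rpow_le_rpow_of_nonpos hn hx.1 (by linarith)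
  have hle : ((n + 1 : ℕ) : ℝ) ≤ ((n + 2 : ℕ) : ℝ) := by push_cast; linarith
  have h := (convex_Icc _ _).norm_image_sub_le_of_norm_hasDerivWithin_le hder hbd
    (Set.left_mem_Icc.2 hle) (Set.right_mem_Icc.2 hle)
  rw [cpowDiff, norm_sub_rev]
  have h1 : ‖((n + 2 : ℕ) : ℝ) - ((n + 1 : ℕ) : ℝ)‖ = 1 := by push_cast; norm_num
  rw [h1, mul_one] at h
  simpa using h

theorem summable_nat_succ_rpow {r : ℝ} (hr : r < -1) :
    Summable fun n : ℕ => ((n + 1 : ℕ) : ℝ) ^ r :=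
  (summable_nat_add_iff 1).2 (Real.summable_nat_rpow.2 hr)

theorem summable_mul_cpowDiff {A : ℕ → ℂ} {M : ℝ} (hA : ∀ n, ‖A n‖ ≤ M) {δ : ℂ} (hδ : 0 < δ.re) :
    Summable fun n => A n * cpowDiff δ n := by
  refine Summable.of_norm_bounded
    ((summable_nat_succ_rpow (r := -δ.re - 1) (by linarith)).mul_left (M * ‖δ‖)) fun n => ?_
  rw [norm_mul, mul_assoc]
  exact mul_le_mul (hA n) (norm_cpowDiff_le hδ.le n) (norm_nonneg _)
    ((norm_nonneg _).trans (hA n))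

theorem differentiableOn_tsum_mul_cpowDiff {A : ℕ → ℂ} {M : ℝ} (hA : ∀ n, ‖A n‖ ≤ M) :
    DifferentiableOn ℂ (fun δ => ∑' n, A n * cpowDiff δ n) {δ | 0 < δ.re} := by
  intro δ₀ hδ₀
  obtain ⟨ε, hε, hεδ⟩ := exists_between (show 0 < δ₀.re from hδ₀)
  -- Bounding `‖δ‖` as well as `Re δ` from below gives a summable majorant uniform on a
  -- neighbourhood of `δ₀`.
  set V : Set ℂ := {δ | ε < δ.re} ∩ Metric.ball 0 (‖δ₀‖ + 1)
  have hV : IsOpen V :=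
    (isOpen_lt continuous_const Complex.continuous_re).inter Metric.isOpen_ball
  have hmem : δ₀ ∈ V := ⟨hεδ, by simp⟩
  refine DifferentiableAt.differentiableWithinAt ?_
  refine (Complex.differentiableOn_tsum_of_summable_norm
    ((summable_nat_succ_rpow (r := -ε - 1) (by linarith)).mul_left (M * (‖δ₀‖ + 1)))
    (fun n => ?_) hV fun n δ hδ => ?_).differentiableAt (hV.mem_nhds hmem)
  · have h1 : ∀ m : ℕ, Differentiable ℂ fun δ : ℂ => ((m + 1 : ℕ) : ℂ) ^ (-δ) := fun m =>
      differentiable_id.neg.const_cpow (Or.inl (by exact_mod_cast m.succ_ne_zero))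
    exact (((h1 n).sub (h1 (n + 1))).const_mul (A n)).differentiableOn
  · have hδn : ‖δ‖ ≤ ‖δ₀‖ + 1 := (by simpa using hδ.2 : ‖δ‖ < ‖δ₀‖ + 1).le
    have hδε : ε < δ.re := hδ.1
    rw [norm_mul, mul_assoc]
    refine mul_le_mul (hA n) ((norm_cpowDiff_le (hε.trans hδε).le n).trans ?_) (norm_nonneg _)
      ((norm_nonneg _).trans (hA n))
    gcongr
    · push_cast; linarith [n.cast_nonneg (α := ℝ)]

theorem tendsto_natCast_succ_cpow_neg {δ : ℂ} (hδ : 0 < δ.re) :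
    Tendsto (fun N : ℕ => ((N + 1 : ℕ) : ℂ) ^ (-δ)) atTop (𝓝 0) := by
  rw [tendsto_zero_iff_norm_tendsto_zero]
  have h := (tendsto_rpow_neg_atTop hδ).comp
    (tendsto_natCast_atTop_atTop.comp (tendsto_add_atTop_nat 1))
  refine h.congr fun N => ?_
  rw [← Complex.ofReal_natCast, Complex.norm_cpow_eq_rpow_re_of_pos (by positivity)]
  simp

/-- Toeplitz's argument: the tail is small because `B` is small there and the weights have total
mass `1`; the finitely many remaining weights tend to `0`. -/
theorem tendsto_tsum_mul_of_tendsto_zero {B : ℕ → ℂ} (hB : Tendsto B atTop (𝓝 0)) {l : Filter ℝ}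
    {w : ℝ → ℕ → ℝ} (hw0 : ∀ᶠ δ in l, ∀ n, 0 ≤ w δ n) (hw1 : ∀ᶠ δ in l, HasSum (w δ) 1)
    (hw : ∀ n, Tendsto (fun δ => w δ n) l (𝓝 0)) :
    Tendsto (fun δ => ∑' n, B n * (w δ n : ℂ)) l (𝓝 0) := by
  rw [Metric.tendsto_nhds]
  intro ε hε
  have hB' := (tendsto_zero_iff_norm_tendsto_zero.1 hB).eventually (gt_mem_nhds (half_pos hε))
  obtain ⟨N, hN⟩ := eventually_atTop.1 hB'
  have hfin : Tendsto (fun δ => ∑ n ∈ Finset.range N, ‖B n‖ * w δ n) l (𝓝 0) := by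
    have := tendsto_finsetSum (Finset.range N) fun n _ => (hw n).const_mul ‖B n‖
    simpa using this
  filter_upwards [hw0, hw1, hfin.eventually (gt_mem_nhds (half_pos hε))] with δ h0 h1 h2
  rw [dist_zero_right]
  set b : ℕ → ℝ := fun n => (if n < N then ‖B n‖ * w δ n else 0) + ε / 2 * w δ n
  have hb : HasSum b ((∑ n ∈ Finset.range N, ‖B n‖ * w δ n) + ε / 2 * 1) := by
    refine HasSum.add ?_ (h1.mul_left _)
    rw [Finset.sum_congr rfl fun n hn => (if_pos (c := n < N) (t := ‖B n‖ * w δ n) (e := 0)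
      (Finset.mem_range.1 hn)).symm]
    exact hasSum_sum_of_ne_finset_zero fun n hn => if_neg (by simpa using hn)
  have := tsum_of_norm_bounded (f := fun n => B n * (w δ n : ℂ)) hb fun n => ?_
  · linarith
  · rw [norm_mul, Complex.norm_real, Real.norm_of_nonneg (h0 n)]
    simp only [b]
    split_ifs with hn
    · have := mul_nonneg (half_pos hε).le (h0 n)
      linarith
    · rw [zero_add]
      gcongr
      · exact h0 n
      · exact (hN n (not_lt.1 hn)).le

theorem cpowDiff_ofReal (δ : ℝ) (n : ℕ) :
    cpowDiff δ n =
      ((((n + 1 : ℕ) : ℝ) ^ (-δ) - ((n + 2 : ℕ) : ℝ) ^ (-δ) : ℝ) : ℂ) := by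
  rw [cpowDiff, Complex.ofReal_sub, Complex.ofReal_cpow (by positivity),
    Complex.ofReal_cpow (by positivity)]
  push_cast
  rfl

/-- For real `δ > 0` the differences are nonnegative, telescope to total mass `1` and vanish
individually as `δ → 0`, so they average `A` towards its limit. -/
theorem tendsto_tsum_mul_cpowDiff {A : ℕ → ℂ} {M : ℝ} {D : ℂ} (hA : ∀ n, ‖A n‖ ≤ M)
    (hD : Tendsto A atTop (𝓝 D)) :
    Tendsto (fun δ : ℝ => ∑' n, A n * cpowDiff δ n) (𝓝[>] 0) (𝓝 D) := by
  set w : ℝ → ℕ → ℝ := fun δ n => ((n + 1 : ℕ) : ℝ) ^ (-δ) - ((n + 2 : ℕ) : ℝ) ^ (-δ)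
  have hw0 : ∀ᶠ δ : ℝ in 𝓝[>] 0, ∀ n, 0 ≤ w δ n := by
    filter_upwards [self_mem_nhdsWithin] with δ hδ n
    refine sub_nonneg.2 (Real.rpow_le_rpow_of_nonpos (by positivity) ?_ ?_)
    · push_cast; linarith
    · exact neg_nonpos.2 (Set.mem_Ioi.1 hδ).le
  have hw1 : ∀ᶠ δ : ℝ in 𝓝[>] 0, HasSum (w δ) 1 := by
    filter_upwards [hw0, self_mem_nhdsWithin] with δ h0 hδ
    refine (hasSum_iff_tendsto_nat_of_nonneg h0 1).2 ?_
    have hsum : ∀ N, ∑ n ∈ Finset.range N, w δ n = 1 - ((N + 1 : ℕ) : ℝ) ^ (-δ) := fun N => by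
      have := Finset.sum_range_sub' (fun n : ℕ => ((n + 1 : ℕ) : ℝ) ^ (-δ)) N
      simpa [w, add_assoc, one_add_one_eq_two] using this
    simp only [hsum]
    have h := (tendsto_rpow_neg_atTop (Set.mem_Ioi.1 hδ)).comp
      (tendsto_natCast_atTop_atTop.comp (tendsto_add_atTop_nat 1))
    simpa using h.const_sub 1
  have hw : ∀ n, Tendsto (fun δ => w δ n) (𝓝[>] 0) (𝓝 0) := fun n => by
    have hc : ∀ m : ℕ, Continuous fun δ : ℝ => ((m + 1 : ℕ) : ℝ) ^ (-δ) := fun m =>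
      Real.continuous_const_rpow (by positivity) |>.comp continuous_neg
    have : Tendsto (fun δ => w δ n) (𝓝 0) (𝓝 (w 0 n)) :=
      ((hc n).sub (hc (n + 1))).tendsto 0
    simp only [w] at this ⊢
    rw [neg_zero, Real.rpow_zero, Real.rpow_zero, sub_self] at this
    exact this.mono_left nhdsWithin_le_nhds
  have hB : Tendsto (fun n => A n - D) atTop (𝓝 0) := by simpa using hD.sub_const D
  have h := (tendsto_tsum_mul_of_tendsto_zero hB hw0 hw1 hw).add_const D
  rw [zero_add] at h
  refine h.congr' ?_
  filter_upwards [hw1, self_mem_nhdsWithin] with δ h1 hδ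
  have hs := summable_mul_cpowDiff hA (δ := δ) (by simpa using hδ)
  have h1' : HasSum (fun n => (w δ n : ℂ)) 1 := by
    simpa using Complex.hasSum_ofReal.2 h1
  have hcd : ∀ n, cpowDiff δ n = (w δ n : ℂ) := cpowDiff_ofReal δ
  simp only [hcd] at hs ⊢
  have h2 := (hs.hasSum.sub (h1'.mul_left D)).tsum_eq
  simp only [← sub_mul, mul_one] at h2
  rw [h2, sub_add_cancel]

end AbelSummation

/-! ### Dirichlet composition -/

section Dirichlet

variable {σ : ℝ} {a : ℕ → ℂ} {g : ℂ → ℂ} {s₀ D : ℂ}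

/-- Terms are differences of bounded partial sums. This gives absolute convergence for `Re s > Re s₀
+ 1`, as termwise integration requires. -/
theorem exists_norm_coeff_le
    (hD : Tendsto (dirichletPartialSum a s₀) atTop (𝓝 D)) :
    ∃ M, ∀ n : ℕ, ‖a (n + 1)‖ ≤ M * ((n + 1 : ℕ) : ℝ) ^ s₀.re := by
  obtain ⟨M, hM⟩ := (Metric.isBounded_range_of_tendsto _ hD).exists_norm_le
  refine ⟨M + M, fun n => ?_⟩
  have hn : (0 : ℝ) < ((n + 1 : ℕ) : ℝ) := by positivity
  have h : a (n + 1) * ((n + 1 : ℕ) : ℂ) ^ (-s₀) =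
      dirichletPartialSum a s₀ (n + 1) - dirichletPartialSum a s₀ n := by
    rw [dirichletPartialSum_succ]; ring
  have h2 := (norm_sub_le (dirichletPartialSum a s₀ (n + 1)) (dirichletPartialSum a s₀ n)).trans
    (add_le_add (hM _ ⟨n + 1, rfl⟩) (hM _ ⟨n, rfl⟩))
  rw [← h, norm_mul, ← Complex.ofReal_natCast, Complex.norm_cpow_eq_rpow_re_of_pos hn,
    Complex.neg_re, Real.rpow_neg hn.le, ← div_eq_mul_inv, div_le_iff₀ (by positivity)] at h2
  exact h2

theorem hasSum_mellin_powerSeries_exp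
    (hg : ∀ q : ℂ, ‖q‖ < 1 → HasSum (fun n : ℕ => a (n + 1) * q ^ (n + 1)) (g q))
    (hD : Tendsto (dirichletPartialSum a s₀) atTop (𝓝 D)) {s : ℂ} (hs : 0 < s.re)
    (hs₀ : s₀.re + 1 < s.re) :
    HasSum (fun n : ℕ => Complex.Gamma s * (a (n + 1) * ((n + 1 : ℕ) : ℂ) ^ (-s)))
      (mellin (fun x : ℝ => g (Complex.exp (-(x : ℂ)))) s) := by
  obtain ⟨M, hM⟩ := exists_norm_coeff_le hD
  have h := hasSum_mellin (a := fun n : ℕ => a (n + 1)) (p := fun n : ℕ => ((n + 1 : ℕ) : ℝ))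
    (F := fun x : ℝ => g (Complex.exp (-(x : ℂ)))) (s := s)
    (fun n => Or.inr (by positivity)) hs ?_ ?_
  · refine (congrArg (fun F : ℕ → ℂ => HasSum F _) (funext fun n => ?_)).mp h
    rw [Complex.ofReal_natCast, Complex.cpow_neg, mul_div_assoc, div_eq_mul_inv]
  · intro t ht
    have := hg (Complex.exp (-(t : ℂ))) (by
      rw [Complex.norm_exp]; simpa using ht)
    refine (congrArg (fun F : ℕ → ℂ => HasSum F _) (funext fun n => ?_)).mp this
    rw [← Complex.exp_nat_mul, Complex.ofReal_exp]
    congr 2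
    push_cast
    ring
  · refine Summable.of_nonneg_of_le (fun n => by positivity) (fun n => ?_)
      ((summable_nat_succ_rpow (r := s₀.re - s.re) (by linarith)).mul_left M)
    have hn : (0 : ℝ) < ((n + 1 : ℕ) : ℝ) := by positivity
    rw [Real.rpow_sub hn, ← mul_div_assoc]
    gcongr
    exact hM n

/-- Decay faster than every power removes the right edge of the half-plane of holomorphy. -/
theorem differentiable_pmt_of_forall_admissible {f : ℂ → ℂ} {c : ℝ} (hσ : 0 < σ)
    (hf : ∀ b : ℝ, PMTAdmissible σ c b f) : Differentiable ℂ (pmt σ f) := fun z =>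
  ((hf (z.re + 2)).differentiableOn_pmt hσ).differentiableAt
    ((isOpen_lt (by fun_prop) continuous_const).mem_nhds (by
      show z.re + 1 / 2 < z.re + 2
      linarith))

theorem pmt_exp_eq_Gamma (hσ : 0 < σ) {z : ℂ} (hz : 0 < z.re + 1 / 2) :
    pmt σ Complex.exp z = Complex.cos (Real.pi * z) * Complex.Gamma (z + 1 / 2) := by
  rw [(pmtAdmissible_exp hσ.le (z.re + 1)).pmt_eq_mellin hσ hz (by linarith),
    Complex.Gamma_eq_integral (by simpa using hz), Complex.GammaIntegral_eq_mellin]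
  simp

theorem pmt_comp_exp_eq_of_re_gt {c : ℝ} (hσ : 0 < σ)
    (hg : ∀ q : ℂ, ‖q‖ < 1 → HasSum (fun n : ℕ => a (n + 1) * q ^ (n + 1)) (g q))
    (hf : ∀ b : ℝ, PMTAdmissible σ c b fun u => g (Complex.exp u))
    (hD : Tendsto (dirichletPartialSum a s₀) atTop (𝓝 D)) {δ : ℂ} (h1 : 1 < δ.re)
    (hc : c < (s₀ + δ).re) (h0 : 0 < (s₀ + δ).re) :
    pmt σ (fun u => g (Complex.exp u)) (s₀ + δ - 1 / 2) = pmt σ Complex.exp (s₀ + δ - 1 / 2) *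
      ∑' n, dirichletPartialSum a s₀ (n + 1) * cpowDiff δ n := by
  obtain ⟨M, hM⟩ := (Metric.isBounded_range_of_tendsto _ hD).exists_norm_le
  have hre : (s₀ + δ - 1 / 2).re + 1 / 2 = (s₀ + δ).re := by simp
  have hH : Tendsto (fun N => ∑ n ∈ Finset.range N, a (n + 1) * ((n + 1 : ℕ) : ℂ) ^ (-(s₀ + δ)))
      atTop (𝓝 (∑' n, dirichletPartialSum a s₀ (n + 1) * cpowDiff δ n)) := by
    simp only [sum_range_dirichlet_eq]
    have hsum := (summable_mul_cpowDiff (A := fun n => dirichletPartialSum a s₀ (n + 1))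
      (fun n => hM _ ⟨n + 1, rfl⟩) (δ := δ) (by linarith)).hasSum.tendsto_sum_nat
    simpa using (hD.mul (tendsto_natCast_succ_cpow_neg (δ := δ) (by linarith))).add hsum
  have hmel := (hasSum_mellin_powerSeries_exp hg hD h0 (by
    rw [Complex.add_re]; linarith)).tendsto_sum_nat
  simp only [← Finset.mul_sum] at hmel
  have heq := tendsto_nhds_unique hmel (hH.const_mul (Complex.Gamma (s₀ + δ)))
  rw [(hf ((s₀ + δ).re + 1)).pmt_eq_mellin hσ (hre.symm ▸ hc) (by rw [hre]; linarith),
    pmt_exp_eq_Gamma hσ (hre.symm ▸ h0), sub_add_cancel, heq, mul_assoc]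

theorem pmt_comp_exp_eq {c : ℝ} (hσ : 0 < σ)
    (hg : ∀ q : ℂ, ‖q‖ < 1 → HasSum (fun n : ℕ => a (n + 1) * q ^ (n + 1)) (g q))
    (hf : ∀ b : ℝ, PMTAdmissible σ c b fun u => g (Complex.exp u))
    (hD : Tendsto (dirichletPartialSum a s₀) atTop (𝓝 D)) :
    pmt σ (fun u => g (Complex.exp u)) (s₀ - 1 / 2) = pmt σ Complex.exp (s₀ - 1 / 2) * D := by
  obtain ⟨M, hM⟩ := (Metric.isBounded_range_of_tendsto _ hD).exists_norm_le
  set A : ℕ → ℂ := fun n => dirichletPartialSum a s₀ (n + 1)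
  have hA : ∀ n, ‖A n‖ ≤ M := fun n => hM _ ⟨n + 1, rfl⟩
  set P : ℂ → ℂ := fun δ => pmt σ (fun u => g (Complex.exp u)) (s₀ + δ - 1 / 2)
  set E : ℂ → ℂ := fun δ => pmt σ Complex.exp (s₀ + δ - 1 / 2)
  set H : ℂ → ℂ := fun δ => ∑' n, A n * cpowDiff δ n
  have hP : Differentiable ℂ P :=
    (differentiable_pmt_of_forall_admissible hσ hf).comp (by fun_prop)
  have hE : Differentiable ℂ E :=
    (differentiable_pmt_of_forall_admissible hσ (pmtAdmissible_exp hσ.le)).comp (by fun_prop)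
  have hopen : IsOpen {δ : ℂ | 0 < δ.re} := isOpen_lt continuous_const Complex.continuous_re
  have hEH := (hE.differentiableOn.mul (differentiableOn_tsum_mul_cpowDiff hA)).analyticOnNhd hopen
  -- Beyond this threshold `Re δ > 1`, `Re (s₀ + δ) > c` and `Re (s₀ + δ) > 0`, so the termwise
  -- formula holds.
  set K : ℝ := max 1 (|c| + |s₀.re|)
  have hK1 : 1 ≤ K := le_max_left _ _
  have hK2 : |c| + |s₀.re| ≤ K := le_max_right _ _
  have hmem : ((K + 1 : ℝ) : ℂ) ∈ {δ : ℂ | 0 < δ.re} := by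
    show 0 < ((K + 1 : ℝ) : ℂ).re
    rw [Complex.ofReal_re]; linarith
  have heq : Set.EqOn P (E * H) {δ : ℂ | 0 < δ.re} := by
    refine (hP.differentiableOn.analyticOnNhd hopen).eqOn_of_preconnected_of_eventuallyEq hEH
      (convex_halfSpace_re_gt 0).isPreconnected hmem ?_
    have hnhds : {δ : ℂ | K < δ.re} ∈ 𝓝 ((K + 1 : ℝ) : ℂ) :=
      (isOpen_lt continuous_const Complex.continuous_re).mem_nhds (by
        show K < ((K + 1 : ℝ) : ℂ).re
        rw [Complex.ofReal_re]; linarith)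
    filter_upwards [hnhds] with δ hδ
    have hδ' : K < δ.re := hδ
    refine pmt_comp_exp_eq_of_re_gt hσ hg hf hD (by linarith) ?_ ?_
    · rw [Complex.add_re]; linarith [neg_abs_le s₀.re, le_abs_self c]
    · rw [Complex.add_re]; linarith [neg_abs_le s₀.re, abs_nonneg c]
  have hlim : ∀ {F : ℂ → ℂ}, Differentiable ℂ F →
      Tendsto (fun δ : ℝ => F δ) (𝓝[>] 0) (𝓝 (F 0)) := fun {F} hF => by
    have := (hF.continuous.comp Complex.continuous_ofReal).tendsto 0
    simp only [Function.comp_apply, Complex.ofReal_zero] at this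
    exact this.mono_left nhdsWithin_le_nhds
  -- The point `s₀` is approached along real `δ ↓ 0`, so conditional convergence suffices; the index
  -- shift matches `A n`, the partial sum up to `n + 1`.
  have hright := (hlim hE).mul
    (tendsto_tsum_mul_cpowDiff hA (hD.comp (tendsto_add_atTop_nat 1)))
  have := tendsto_nhds_unique ((hlim hP).congr' ?_) hright
  · simpa [P, E] using this
  · filter_upwards [self_mem_nhdsWithin] with δ hδ
    exact heq (by simpa using hδ)

theorem pmt_dirichlet_composition (hσ : 0 < σ)
    (hg : ∀ q : ℂ, ‖q‖ < 1 → HasSum (fun n : ℕ => a (n + 1) * q ^ (n + 1)) (g q))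
    (hana : AnalyticOnNhd ℂ (fun u => g (Complex.exp u)) (parabolicRegion 0 σ \ {0}))
    (hmer : MeromorphicAt (fun u => g (Complex.exp u)) 0) :
    (∀ z D : ℂ,
        Tendsto (fun N : ℕ => ∑ n ∈ Finset.Icc 1 N, a n * (n : ℂ) ^ (-(z + 1 / 2)))
          atTop (𝓝 D) →
        PMTConvergent σ (fun u => g (Complex.exp u)) z ∧
        pmt σ (fun u => g (Complex.exp u)) z = pmt σ Complex.exp z * D) ∧
      (∀ (U : Set ℂ) (D : ℂ → ℂ) (s₁ : ℂ), IsOpen U → IsPreconnected U →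
        DifferentiableOn ℂ D U → s₁ ∈ U →
        (∀ᶠ s in 𝓝 s₁,
          Tendsto (fun N : ℕ => ∑ n ∈ Finset.Icc 1 N, a n * (n : ℂ) ^ (-s)) atTop (𝓝 (D s))) →
        ∀ z : ℂ, z + 1 / 2 ∈ U →
          PMTConvergent σ (fun u => g (Complex.exp u)) z ∧
          pmt σ (fun u => g (Complex.exp u)) z = pmt σ Complex.exp z * D (z + 1 / 2)) := by
  obtain ⟨c, hf⟩ := exists_pmtAdmissible_comp_exp hσ.le hg hana hmer
  have hconv : ∀ z, PMTConvergent σ (fun u => g (Complex.exp u)) z := fun z =>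
    (hf (z.re + 1)).pmtConvergent hσ (by linarith)
  refine ⟨fun z D hD => ⟨hconv z, ?_⟩, fun U D s₁ hU hUc hDd hs₁ hev z hz => ⟨hconv z, ?_⟩⟩
  · have := pmt_comp_exp_eq (s₀ := z + 1 / 2) hσ hg hf hD
    rwa [add_sub_cancel_right] at this
  · have hP : Differentiable ℂ fun s => pmt σ (fun u => g (Complex.exp u)) (s - 1 / 2) :=
      (differentiable_pmt_of_forall_admissible hσ hf).comp (by fun_prop)
    have hE : Differentiable ℂ fun s => pmt σ Complex.exp (s - 1 / 2) :=
      (differentiable_pmt_of_forall_admissible hσ (pmtAdmissible_exp hσ.le)).comp (by fun_prop)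
    -- Both transforms are entire, so the formula near `s₁` spreads over `U` by the identity
    -- theorem.
    have heq := (hP.differentiableOn.analyticOnNhd hU).eqOn_of_preconnected_of_eventuallyEq
      ((hE.differentiableOn.mul hDd).analyticOnNhd hU) hUc hs₁ (by
        filter_upwards [hev] with s hs
        exact pmt_comp_exp_eq hσ hg hf hs)
    simpa using heq hz

end Dirichlet

theorem mainTheorem6 (σ : ℝ) (hσ : 0 < σ) :
    -- (i) linearity
    (∀ (f₁ f₂ : ℂ → ℂ) (c₁ c₂ z : ℂ), PMTConvergent σ f₁ z → PMTConvergent σ f₂ z →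
      PMTConvergent σ (fun u => c₁ * f₁ u + c₂ * f₂ u) z ∧
      pmt σ (fun u => c₁ * f₁ u + c₂ * f₂ u) z = c₁ * pmt σ f₁ z + c₂ * pmt σ f₂ z) ∧
    -- (ii) scaling, with the aperture transported along `w ↦ √α w`
    (∀ (f : ℂ → ℂ) (α : ℝ) (z : ℂ), 0 < α → PMTConvergent (√α * σ) f z →
      PMTConvergent σ (fun u => f ((α : ℂ) * u)) z ∧
      pmt σ (fun u => f ((α : ℂ) * u)) z =
        (α : ℂ) ^ (-(z + 1 / 2)) * pmt (√α * σ) f z) ∧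
    -- (ii) scaling, with one and the same aperture
    (∀ (f : ℂ → ℂ) (α b : ℝ) (z : ℂ), 0 < α →
      AnalyticOnNhd ℂ f (parabolicRegion σ (√α * σ)) →
      (f =O[Bornology.cobounded ℂ ⊓ 𝓟 (parabolicRegion σ (√α * σ))]
        fun u : ℂ => ‖u‖ ^ (-b)) →
      z.re + 1 / 2 < b →
      PMTConvergent σ f z ∧ PMTConvergent σ (fun u => f ((α : ℂ) * u)) z ∧
      pmt σ (fun u => f ((α : ℂ) * u)) z = (α : ℂ) ^ (-(z + 1 / 2)) * pmt σ f z) ∧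
    -- (iii) monomial shift
    (∀ (f : ℂ → ℂ) (k : ℕ) (z : ℂ), PMTConvergent σ f (z + k) →
      PMTConvergent σ (fun u => u ^ k * f u) z ∧
      pmt σ (fun u => u ^ k * f u) z = pmt σ f (z + k)) ∧
    -- (iv) differentiation with respect to `z`
    (∀ (f : ℂ → ℂ) (z z₀ : ℂ), PMTConvergent σ f z₀ → z.re < z₀.re →
      PMTConvergent σ (fun u => f u * Complex.log u) z ∧
      HasDerivAt (pmt σ f) (pmt σ (fun u => f u * Complex.log u) z) z) ∧
    -- (v) Dirichlet composition, where the Dirichlet series converges and, after that, for its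
    -- analytic continuations
    (∀ (a : ℕ → ℂ) (g : ℂ → ℂ),
      (∀ q : ℂ, ‖q‖ < 1 → HasSum (fun n : ℕ => a (n + 1) * q ^ (n + 1)) (g q)) →
      AnalyticOnNhd ℂ (fun u => g (Complex.exp u)) (parabolicRegion 0 σ \ {0}) →
      MeromorphicAt (fun u => g (Complex.exp u)) 0 →
      (∀ z D : ℂ,
        Tendsto (fun N : ℕ => ∑ n ∈ Finset.Icc 1 N, a n * (n : ℂ) ^ (-(z + 1 / 2)))
          atTop (𝓝 D) →
        PMTConvergent σ (fun u => g (Complex.exp u)) z ∧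
        pmt σ (fun u => g (Complex.exp u)) z = pmt σ Complex.exp z * D) ∧
      (∀ (U : Set ℂ) (D : ℂ → ℂ) (s₁ : ℂ), IsOpen U → IsPreconnected U →
        DifferentiableOn ℂ D U → s₁ ∈ U →
        (∀ᶠ s in 𝓝 s₁,
          Tendsto (fun N : ℕ => ∑ n ∈ Finset.Icc 1 N, a n * (n : ℂ) ^ (-s)) atTop (𝓝 (D s))) →
        ∀ z : ℂ, z + 1 / 2 ∈ U →
          PMTConvergent σ (fun u => g (Complex.exp u)) z ∧
          pmt σ (fun u => g (Complex.exp u)) z = pmt σ Complex.exp z * D (z + 1 / 2))) ∧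
    -- (vi) connection to the classical Mellin transform; the left side has no poles
    (∀ (f : ℂ → ℂ) (a b : ℝ), PMTAdmissible σ a b f →
      (∀ z : ℂ, a < z.re + 1 / 2 → z.re + 1 / 2 < b →
        PMTConvergent σ f z ∧
        MellinConvergent (fun x : ℝ => f (-(x : ℂ))) (z + 1 / 2) ∧
        pmt σ f z = Complex.cos (Real.pi * z) *
          mellin (fun x : ℝ => f (-(x : ℂ))) (z + 1 / 2)) ∧
      DifferentiableOn ℂ (pmt σ f) {z : ℂ | z.re + 1 / 2 < b}) ∧
    -- (vii) parabolic convolution; `h` is `f ⋆ g`, continued from the negative axis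
    (∀ (f g h : ℂ → ℂ) (a₁ b₁ a₂ b₂ a₃ b₃ ρ : ℝ) (z : ℂ), 0 < ρ →
      PMTAdmissible σ a₁ b₁ f → PMTAdmissible σ a₂ b₂ g → PMTSlitAdmissible ρ a₃ b₃ h →
      (∀ x : ℝ, 0 < x → h (-(x : ℂ)) = parabolicConv f g (-(x : ℂ))) →
      z.re + 1 / 2 ∈ Set.Ioo a₁ b₁ → z.re + 1 / 2 ∈ Set.Ioo a₂ b₂ →
      z.re + 1 / 2 ∈ Set.Ioo a₃ b₃ →
      (∀ x : ℝ, 0 < x →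
        IntegrableOn (fun y : ℝ => f (-(y : ℂ)) * g (-(x : ℂ) / (y : ℂ)) / (y : ℂ))
          (Set.Ioi 0)) ∧
      (∀ᶠ ρ' : ℝ in 𝓝[>] 0, PMTConvergent ρ' h z) ∧
      (Complex.cos (Real.pi * z) ≠ 0 →
        Tendsto (fun ρ' : ℝ => pmt ρ' h z) (𝓝[>] 0)
          (𝓝 ((Complex.cos (Real.pi * z))⁻¹ * pmt σ f z * pmt σ g z)))) ∧
    -- (viii) inversion formula
    (∀ (f : ℂ → ℂ) (a b θ γ : ℝ), PMTAdmissible σ a b f → 0 < θ → θ ≤ Real.pi →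
      DifferentiableOn ℂ f (negSector θ) →
      (∀ ψ : ℝ, 0 < ψ → ψ < θ →
        f =O[Bornology.cobounded ℂ ⊓ 𝓟 (negSector ψ)] fun u : ℂ => ‖u‖ ^ (-b)) →
      a < γ + 1 / 2 → γ + 1 / 2 < b →
      ∀ u ∈ negSector θ,
        Integrable (fun τ : ℝ =>
          pmt σ f (γ + τ * Complex.I) * (Complex.cos (Real.pi * (γ + τ * Complex.I)))⁻¹ *
            (-u) ^ (-((γ + τ * Complex.I : ℂ) + 1 / 2))) ∧
        f u = 1 / (2 * Real.pi) * ∫ τ : ℝ,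
          pmt σ f (γ + τ * Complex.I) * (Complex.cos (Real.pi * (γ + τ * Complex.I)))⁻¹ *
            (-u) ^ (-((γ + τ * Complex.I : ℂ) + 1 / 2))) := by
  refine ⟨fun f₁ f₂ c₁ c₂ z h₁ h₂ => pmt_linear c₁ c₂ h₁ h₂,
    fun f α z hα h => pmt_comp_mul hα hσ h,
    fun f α b z hα hf hi hz => pmt_comp_mul_same hσ hα hf hi hz,
    fun f k z h => pmt_monomial hσ h,
    fun f z z₀ h hz => pmt_hasDerivAt hσ h hz,
    fun a g hg hana hmer => pmt_dirichlet_composition hσ hg hana hmer,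
    fun f a b hf => ⟨fun z ha hb => ⟨hf.pmtConvergent hσ hb,
      hf.slitAdmissible.mellinConvergent hσ.le (by simpa using ha) (by simpa using hb),
      hf.pmt_eq_mellin hσ ha hb⟩, hf.differentiableOn_pmt hσ⟩,
    fun f g h a₁ b₁ a₂ b₂ a₃ b₃ ρ z hρ hf hg hh hconv h₁ h₂ h₃ =>
      pmt_parabolicConv hσ hρ hf hg hh hconv h₁ h₂ h₃,
    fun f a b θ γ hf _ hθ hd hi ha hb u hu => pmt_inversion hσ hf hθ hd hi ha hb hu⟩
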